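/- Let $D\subset\mathbb C\times\mathbb C$ be a measurable set and let $\mathrm d\zeta=w\,\mathrm d\mu$ be a complex measure, where $\mu$ is an arbitrary positive measure on $\mathbb C\times\mathbb C$ and $w$ is a complex density. For $n\in\mathbb Z$ and real variables $x_1,x_{-1}$ put $$\rho_n(k)=\mathrm e^{kx_1+k^{-1}x_{-1}}k^n,\qquad \sigma_n(k')=\mathrm e^{k'x_1+k'^{-1}x_{-1}}(-k')^{-n}.$$ All matrices below are infinite matrices indexed by $\mathbb Z\times\mathbb Z$: $O$ has a single nonzero entry, equal to $1$, at $(0,0)$; $\Lambda=(\delta_{i+1,j})_{i,j}$ is the index-raising matrix and ${}^t\Lambda$ its transpose (and inverse); $$\Omega=-\sum_{i=0}^\infty(-{}^t\Lambda)^{-i-1}O\Lambda^i,\qquad C_n=\iint_D\mathrm d\zeta(k,k')\,\rho_n(k)\,c(k)\,{}^tc(k')\,\sigma_n(k'),$$ where $c(k)={}^t(\dots,k^{-1},1,k,\dots)$; that is, $C_n^{(i,j)}=\iint_D\rho_n(k)\sigma_n(k')k^ik'^j\,\mathrm d\zeta(k,k')$. Assume that the sums and integrals converge absolutely in the following sense: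 there is $s>0$ with $0<|k|<s<|k'|$ for all $(k,k')\in D$, and, for all $(x_1,x_{-1})$ in an open set $V\subset\mathbb R^2$ and all $n,i,j\in\mathbb Z$, $$\iint_D\frac{|\rho_n(k)\,\sigma_n(k')\,k^i\,k'^j|}{(s-|k|)(|k'|-s)}\,|w|\,\mathrm d\mu<\infty .$$ Then for every $n\in\mathbb Z$ and $(x_1,x_{-1})\in V$ the tau function $$\tau_n=\det(1+\Omega C_n)$$ is well defined, where $\det(1+A)$ denotes the value at $z=1$ of the entire function of $z$ that near $z=0$ equals $$\det(1+zA)=\exp\{\operatorname{tr}\ln(1+zA)\}=\exp\Big\{\sum_{i\ge1}\frac{(-1)^{i-1}}{i}\operatorname{tr}\big((zA)^i\big)\Big\}$$ (so that it is the value of the right-hand side at $z=1$ whenever the series converges there). Moreover, the partial derivatives $\partial_1\tau_n$, $\partial_{-1}\tau_n$ and $\partial_1\partial_{-1}\tau_n$ exist on $V$, and $\tau_n$ solves the bilinear two-dimensional Toda equation $$\tfrac12\,\mathrm D_1\mathrm D_{-1}\,\tau_n\cdot\tau_n=\tau_n^2-\tau_{n+1}\tau_{n-1}\qquad\text{on }V\text{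 for all }n\in\mathbb Z,$$ where $\mathrm D_1\mathrm D_{-1}f\cdot g=(\partial_{x_1}-\partial_{x_1'})(\partial_{x_{-1}}-\partial_{x_{-1}'})\,f(x_1,x_{-1})\,g(x_1',x_{-1}')\big|_{x_1'=x_1,\;x_{-1}'=x_{-1}}$ is Hirota's bilinear derivative. -/

import Mathlib

open Filter Topology MeasureTheory

noncomputable section

namespace TodaDL

/-! ### Matrices of size `∞ × ∞`, indexed by `ℤ × ℤ` -/

/-- Product of two infinite matrices. -/
def imul (U V : Matrix ℤ ℤ ℂ) : Matrix ℤ ℤ ℂ :=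
  fun i j => ∑' l : ℤ, U i l * V l j

/-- Powers of an infinite matrix. -/
def ipow (U : Matrix ℤ ℤ ℂ) : ℕ → Matrix ℤ ℤ ℂ
  | 0 => 1
  | m + 1 => imul (ipow U m) U

/-- Trace of an infinite matrix. -/
def itrace (U : Matrix ℤ ℤ ℂ) : ℂ := ∑' i : ℤ, U i i

/-- The projection matrix: its only nonzero entry is a `1` at `(0, 0)`. -/
def projO : Matrix ℤ ℤ ℂ := fun i j => if i = 0 ∧ j = 0 then 1 else 0

/-- The index-raising matrix `Λ`, `(Λ U) i j = U (i + 1) j`. -/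
def Lam : Matrix ℤ ℤ ℂ := fun i j => if j = i + 1 then 1 else 0

/-- `-Λ` is a right inverse of `-ᵗΛ`. -/
theorem imul_neg_transpose_neg : imul (-Lam.transpose) (-Lam) = 1 := by
  ext i j
  simp only [imul, Matrix.neg_apply, Matrix.transpose_apply, Lam, neg_mul_neg, Matrix.one_apply]
  rw [tsum_eq_single (i - 1)]
  · simp [eq_comm]
  · intro l hl
    have : ¬ i = l + 1 := fun h => hl (by omega)
    simp [this]

/-- `-Λ` is a left inverse of `-ᵗΛ`. -/
theorem imul_neg_neg_transpose : imul (-Lam) (-Lam.transpose) = 1 := by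
  ext i j
  simp only [imul, Matrix.neg_apply, Matrix.transpose_apply, Lam, neg_mul_neg, Matrix.one_apply]
  rw [tsum_eq_single (i + 1)]
  · simp
  · intro l hl
    simp [hl]

/-- `(-ᵗΛ)^{-m}` for `m : ℕ`, the `m`-th power of the inverse `-Λ` of `-ᵗΛ`. -/
def negLamTInvPow (m : ℕ) : Matrix ℤ ℤ ℂ := ipow (-Lam) m

/-- `Ω = -∑_{i ≥ 0} (-ᵗΛ)^{-i-1} O Λ^i`. -/
def Omega : Matrix ℤ ℤ ℂ :=
  fun a b => -∑' i : ℕ, imul (imul (negLamTInvPow (i + 1)) projO) (ipow Lam i) a b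

/-! ### The determinant `det (1 + A) = exp (tr (ln (1 + A)))` -/

/-- The coefficient `(-1)^{i-1} / i * tr (A^i)`, `i = m + 1`, in the expansion of
`tr (ln (1 + A))`. -/
def logDetCoeff (A : Matrix ℤ ℤ ℂ) (m : ℕ) : ℂ :=
  (-1) ^ m / ((m : ℂ) + 1) * itrace (ipow A (m + 1))

/-- `d` is the determinant of `1 + A`: all powers of `A` and their traces are given by convergent
sums, and `d` is the value at `z = 1` of the entire function of `z` that is given near `z = 0` by
`det (1 + z A) = exp (∑_{i ≥ 1} (-1)^{i-1} / i * tr ((z A)^i))`. -/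
structure HasDetOneAdd (A : Matrix ℤ ℤ ℂ) (d : ℂ) : Prop where
  summable_mul : ∀ (m : ℕ) (i j : ℤ), Summable fun l : ℤ => ipow A m i l * A l j
  summable_trace : ∀ m : ℕ, Summable fun i : ℤ => ipow A (m + 1) i i
  entire : ∃ F : ℂ → ℂ, Differentiable ℂ F ∧
    (∀ᶠ z in 𝓝 (0 : ℂ), ∃ L : ℂ,
      HasSum (fun m : ℕ => logDetCoeff A m * z ^ (m + 1)) L ∧ F z = Complex.exp L) ∧
    F 1 = d

/-- The determinant of `1 + A` is unique. -/
theorem HasDetOneAdd.unique {A : Matrix ℤ ℤ ℂ} {d d' : ℂ}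
    (h : HasDetOneAdd A d) (h' : HasDetOneAdd A d') : d = d' := by
  obtain ⟨F, hF, hF0, rfl⟩ := h.entire
  obtain ⟨G, hG, hG0, rfl⟩ := h'.entire
  have hFG : F =ᶠ[𝓝 0] G := by
    filter_upwards [hF0, hG0] with z ⟨L, hL, hLF⟩ ⟨M, hM, hMG⟩
    rw [hLF, hMG, hL.unique hM]
  have hFa : AnalyticOnNhd ℂ F Set.univ := fun z _ => hF.analyticAt z
  have hGa : AnalyticOnNhd ℂ G Set.univ := fun z _ => hG.analyticAt z
  exact congrFun (hFa.eq_of_eventuallyEq hGa hFG) 1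

/-- Wherever the expansion of `tr (ln (1 + A))` converges, the determinant of `1 + A` is
`exp (∑_{i ≥ 1} (-1)^{i-1} / i * tr (A^i))`. -/
theorem HasDetOneAdd.eq_exp {A : Matrix ℤ ℤ ℂ} {d L : ℂ} (h : HasDetOneAdd A d)
    (hL : Tendsto (fun N : ℕ => ∑ m ∈ Finset.range N, logDetCoeff A m) atTop (𝓝 L)) :
    d = Complex.exp L := by
  obtain ⟨F, hF, hF0, rfl⟩ := h.entire
  set c := logDetCoeff A with hc
  have hbd : ∃ M : ℝ, ∀ m, ‖c m‖ ≤ M := by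
    have h1 : Tendsto (fun N : ℕ => ∑ m ∈ Finset.range (N + 1), c m - ∑ m ∈ Finset.range N, c m)
        atTop (𝓝 (L - L)) := ((tendsto_add_atTop_iff_nat 1).2 hL).sub hL
    simp only [Finset.sum_range_succ_sub_sum] at h1
    obtain ⟨M, hM⟩ := h1.norm.bddAbove_range
    exact ⟨M, fun m => hM ⟨m, rfl⟩⟩
  obtain ⟨M, hM⟩ := hbd
  have hterm : ∀ r : ℝ, 0 ≤ r → ∀ z : ℂ, ‖z‖ ≤ r → ∀ m, ‖c m * z ^ m‖ ≤ M * r ^ m := by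
    intro r hr z hz m
    rw [norm_mul, norm_pow]
    have hM0 : 0 ≤ M := (norm_nonneg _).trans (hM 0)
    gcongr
    exact hM m
  have hsum : ∀ r : ℝ, 0 ≤ r → r < 1 → Summable fun m : ℕ => M * r ^ m := fun r h0 h1 =>
    (summable_geometric_of_lt_one h0 h1).mul_left M
  have hdiff : DifferentiableOn ℂ (fun z : ℂ => ∑' m : ℕ, c m * z ^ m) (Metric.ball 0 1) := by
    intro z hz
    have hz1 : ‖z‖ < 1 := by simpa using hz
    obtain ⟨r, hzr, hr1⟩ := exists_between hz1
    have hr0 : 0 ≤ r := (norm_nonneg z).trans hzr.le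
    have hd : DifferentiableOn ℂ (fun z : ℂ => ∑' m : ℕ, c m * z ^ m) (Metric.ball 0 r) :=
      Complex.differentiableOn_tsum_of_summable_norm (hsum r hr0 hr1)
        (fun m => by fun_prop) Metric.isOpen_ball
        (fun m w hw => hterm r hr0 w (by simpa using (Metric.mem_ball.1 hw).le) m)
    exact (hd.differentiableAt (Metric.isOpen_ball.mem_nhds (by simpa using hzr)))
      |>.differentiableWithinAt
  have hG : AnalyticOnNhd ℂ (fun z : ℂ => Complex.exp (z * ∑' m : ℕ, c m * z ^ m))
      (Metric.ball 0 1) :=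
    (differentiableOn_id.mul hdiff).cexp.analyticOnNhd Metric.isOpen_ball
  have hFa : AnalyticOnNhd ℂ F (Metric.ball 0 1) := fun z _ => hF.analyticAt z
  have heq : F =ᶠ[𝓝 0] fun z : ℂ => Complex.exp (z * ∑' m : ℕ, c m * z ^ m) := by
    filter_upwards [hF0] with z ⟨K, hK, hKF⟩
    rw [hKF, ← hK.tsum_eq, ← tsum_mul_left]
    congr 2
    ext m
    ring
  have hball : Set.EqOn F (fun z : ℂ => Complex.exp (z * ∑' m : ℕ, c m * z ^ m))
      (Metric.ball 0 1) :=
    hFa.eqOn_of_preconnected_of_eventuallyEq hG (convex_ball (0 : ℂ) 1).isPreconnected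
      (Metric.mem_ball_self one_pos) heq
  have habel := Complex.tendsto_tsum_powerSeries_nhdsWithin_lt hL
  rw [tendsto_map'_iff] at habel
  have hof : Tendsto (fun x : ℝ => (x : ℂ)) (𝓝[<] 1) (𝓝 1) :=
    (Complex.continuous_ofReal.tendsto' 1 1 (by simp)).mono_left nhdsWithin_le_nhds
  have hlim1 : Tendsto (fun x : ℝ => F x) (𝓝[<] 1) (𝓝 (F 1)) :=
    (hF.continuous.tendsto 1).comp hof
  have hlim2 : Tendsto (fun x : ℝ => F x) (𝓝[<] 1) (𝓝 (Complex.exp (1 * L))) := by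
    refine ((hof.mul habel).cexp).congr' ?_
    have hmem : Set.Ioo (0 : ℝ) 1 ∈ 𝓝[<] (1 : ℝ) := Ioo_mem_nhdsLT one_pos
    filter_upwards [hmem] with x hx
    refine (hball ?_).symm
    simp [abs_of_pos hx.1, hx.2]
  rw [tendsto_nhds_unique hlim1 hlim2, one_mul]

open Classical in
/-- The determinant of `1 + A` (`0` if there is none). -/
def detOneAdd (A : Matrix ℤ ℤ ℂ) : ℂ :=
  if h : ∃ d, HasDetOneAdd A d then h.choose else 0

/-! ### The objects of the two-dimensional Toda lattice -/

/-- The components `k^i` of the infinite vector `c(k)`. -/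
def cvec (k : ℂ) (i : ℤ) : ℂ := k ^ i

/-- The plane wave factor `ρ_n(k) = exp (k x₁ + k⁻¹ x₋₁) k^n`. -/
def rho (n : ℤ) (x₁ xm : ℝ) (k : ℂ) : ℂ :=
  Complex.exp (k * x₁ + k⁻¹ * xm) * k ^ n

/-- The plane wave factor `σ_n(k') = exp (k' x₁ + k'⁻¹ x₋₁) (-k')^{-n}`. -/
def sigma (n : ℤ) (x₁ xm : ℝ) (k' : ℂ) : ℂ :=
  Complex.exp (k' * x₁ + k'⁻¹ * xm) * (-k') ^ (-n)

/-- The `(i, j)`-entry of `ρ_n(k) c(k) ᵗc(k') σ_n(k')`, at `p = (k, k')`. -/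
def integrandC (n : ℤ) (x₁ xm : ℝ) (i j : ℤ) (p : ℂ × ℂ) : ℂ :=
  rho n x₁ xm p.1 * cvec p.1 i * cvec p.2 j * sigma n x₁ xm p.2

/-- `C_n = ∬_D dζ(k,k') ρ_n(k) c(k) ᵗc(k') σ_n(k')` for the complex measure `dζ = w dμ`. -/
def Cmat (μ : Measure (ℂ × ℂ)) (w : ℂ × ℂ → ℂ) (D : Set (ℂ × ℂ)) (n : ℤ) (x₁ xm : ℝ) :
    Matrix ℤ ℤ ℂ :=
  fun i j => ∫ p in D, integrandC n x₁ xm i j p * w p ∂μ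

/-- The tau function `τ_n = det (1 + Ω C_n)`. -/
def tau (μ : Measure (ℂ × ℂ)) (w : ℂ × ℂ → ℂ) (D : Set (ℂ × ℂ)) (n : ℤ) (x₁ xm : ℝ) : ℂ :=
  detOneAdd (imul Omega (Cmat μ w D n x₁ xm))

/-- Hirota's bilinear derivative `D₁ D₋₁ f · g`, that is
`(∂/∂x₁ - ∂/∂x₁') (∂/∂x₋₁ - ∂/∂x₋₁') f(x₁, x₋₁) g(x₁', x₋₁')` at `x₁' = x₁`, `x₋₁' = x₋₁`. -/
def hirotaDD (f g : ℝ → ℝ → ℂ) (x₁ xm : ℝ) : ℂ :=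
  let inner : ℝ → ℝ → ℂ := fun s s' =>
    deriv (fun t => f s t * g s' xm) xm - deriv (fun t' => f s xm * g s' t') xm
  deriv (fun s => inner s x₁) x₁ - deriv (fun s' => inner x₁ s') x₁

end TodaDL

end

set_option maxSynthPendingDepth 3

noncomputable section

namespace TodaDL

/-! ### Absolutely summable sequences with values in a Banach space -/

/-! Only the rows of `Ω C_n` with negative index are nonzero, so its powers and traces are governed
by the block over negative indices. Conjugation by the powers of `s` turns this block into a matrix
`A_n` over ℕ × ℕ whose entry in row `i` and column `j` is, up to sign, the moment of `k^{n+i}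
k'^{-n-j-1}` times `s^{j-i}`. Since `|k| < s < |k'|`, its entries are dominated by two geometric
series, whose sums produce exactly the weight `1/((s-|k|)(|k'|-s))` of the hypothesis. Hence the
entries of `A_n` are absolutely summable (`Dominates.exists_summable`).

On such matrices `det(1+A)` is Fredholm's series of principal minors. It is entire and
multiplicative, agrees with `exp(tr ln)` near zero, and has derivatives expressed by `R = (1+A)⁻¹`
(`detOne_mul`, `detOne_smul_eq_exp`, `hasFDerivAt_detOne`). `hasDetOneAdd_of_rows` identifies it
with the determinant over ℤ × ℤ.

The derivatives in `x₁` and `x₋₁` multiply the integrand by `k + k'` and `k⁻¹ + k'⁻¹`. Because of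
the sign `(-1)^i` in row `i`, they act on `A = A_n` as commutators with the left shift `D` and the
right shift `S`, up to one boundary column `a` and one boundary row `B`. Moreover `A_{n+1} = D A S`,
while `A_{n-1}` borders `A` by a row and a column (`TodaRelations`).

If `1+A` and `1+A_{n-1}` are invertible, the commutators cancel under the trace and `∂₁∂₋₁ ln τ_n =
1 - R₀₀ (1 - c + (B R a)₀)`, where `c` is a single moment (`trace_identity`). By Cramer's rule the
two factors are `τ_{n+1}/τ_n` and `τ_{n-1}/τ_n` (`detOne_next`, `detOne_prev`). The relations are
linear, so all matrices may be scaled by `z`; small `z` gives invertibility, and the identity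
theorem reaches `z = 1` (`bilinear`). -/

/-- The absolutely summable sequences in `E`. -/
def L1 (E : Type*) [NormedAddCommGroup E] : Type _ := lp (fun _ : ℕ => E) 1

namespace L1

variable {E F : Type*} [NormedAddCommGroup E] [NormedAddCommGroup F]

instance : NormedAddCommGroup (L1 E) := inferInstanceAs (NormedAddCommGroup (lp (fun _ : ℕ => E) 1))

instance [NormedSpace ℂ E] : NormedSpace ℂ (L1 E) :=
  inferInstanceAs (NormedSpace ℂ (lp (fun _ : ℕ => E) 1))

instance [CompleteSpace E] : CompleteSpace (L1 E) :=
  inferInstanceAs (CompleteSpace (lp (fun _ : ℕ => E) 1))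

/-- The terms of the sequence. -/
def term (f : L1 E) (i : ℕ) : E := (show lp (fun _ : ℕ => E) 1 from f) i

instance : CoeFun (L1 E) fun _ => ℕ → E := ⟨term⟩

theorem ext {f g : L1 E} (h : ∀ i, f i = g i) : f = g := lp.ext (funext h)

@[simp] theorem zero_apply (i : ℕ) : (0 : L1 E) i = 0 := rfl
@[simp] theorem add_apply (f g : L1 E) (i : ℕ) : (f + g) i = f i + g i := rfl
@[simp] theorem sub_apply (f g : L1 E) (i : ℕ) : (f - g) i = f i - g i := rfl
@[simp] theorem neg_apply (f : L1 E) (i : ℕ) : (-f) i = -f i := rfl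
@[simp] theorem smul_apply [NormedSpace ℂ E] (c : ℂ) (f : L1 E) (i : ℕ) : (c • f) i = c • f i := rfl

theorem summable_norm (f : L1 E) : Summable fun i => ‖f i‖ := by
  have := (lp.memℓp (show lp (fun _ : ℕ => E) 1 from f)).summable (by simp)
  simp only [ENNReal.toReal_one, Real.rpow_one] at this
  exact this

theorem norm_eq (f : L1 E) : ‖f‖ = ∑' i, ‖f i‖ := by
  have := lp.norm_eq_tsum_rpow (by simp) (show lp (fun _ : ℕ => E) 1 from f)
  simp only [ENNReal.toReal_one, Real.rpow_one, div_one] at this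
  exact this

theorem norm_apply_le (f : L1 E) (i : ℕ) : ‖f i‖ ≤ ‖f‖ :=
  lp.norm_apply_le_norm (E := fun _ : ℕ => E) one_ne_zero f i

/-- The sequence whose only nonzero term is `x` in position `i`. -/
def single (i : ℕ) (x : E) : L1 E := lp.single (E := fun _ : ℕ => E) 1 i x

theorem single_apply (i : ℕ) (x : E) (j : ℕ) : single i x j = if j = i then x else 0 := by
  change lp.single (E := fun _ : ℕ => E) 1 i x j = _
  rw [lp.single_apply, Pi.single_apply]

@[simp] theorem single_apply_self (i : ℕ) (x : E) : single i x i = x := by simp [single_apply]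

theorem norm_single (i : ℕ) (x : E) : ‖single i x‖ = ‖x‖ :=
  lp.norm_single (E := fun _ : ℕ => E) one_pos i x

theorem hasSum_single (f : L1 E) : HasSum (fun i : ℕ => single i (f i)) f :=
  lp.hasSum_single (E := fun _ : ℕ => E) (by simp) f

variable [NormedSpace ℂ E] [NormedSpace ℂ F]

variable (E) in
/-- `single` as a continuous linear map. -/
def singleL (i : ℕ) : E →L[ℂ] L1 E :=
  LinearMap.mkContinuous
    { toFun := single i
      map_add' := fun x y => ext fun j => by
        simp only [single_apply, add_apply]; split_ifs <;> simp
      map_smul' := fun c x => ext fun j => by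
        simp only [single_apply, smul_apply, RingHom.id_apply]; split_ifs <;> simp }
    1 fun x => by
      rw [one_mul]; exact (norm_single i x).le

@[simp] theorem singleL_apply (i : ℕ) (x : E) : singleL E i x = single i x := rfl

theorem norm_singleL_le (i : ℕ) : ‖singleL E i‖ ≤ 1 := LinearMap.mkContinuous_norm_le _ zero_le_one _

variable (E) in
/-- Evaluation at an index as a continuous linear map. -/
def eval (i : ℕ) : L1 E →L[ℂ] E :=
  LinearMap.mkContinuous
    { toFun := fun f => f i
      map_add' := fun _ _ => rfl
      map_smul' := fun _ _ => rfl }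
    1 fun x => by
      rw [one_mul]; exact norm_apply_le x i

@[simp] theorem eval_apply (i : ℕ) (f : L1 E) : eval E i f = f i := rfl

theorem norm_eval_le (i : ℕ) : ‖eval E i‖ ≤ 1 := LinearMap.mkContinuous_norm_le _ zero_le_one _

/-- Every element of ℓ¹ is the norm-convergent sum of its one-term sequences. -/
theorem clm_ext {T U : L1 E →L[ℂ] F} (h : ∀ i x, T (single i x) = U (single i x)) : T = U := by
  ext f
  have h1 := (hasSum_single f).mapL T
  have h2 := (hasSum_single f).mapL U
  simp only [h] at h1
  exact h1.unique h2

theorem summable_norm_map (T : ℕ → E →L[ℂ] F) {K : ℝ} (hT : ∀ i, ‖T i‖ ≤ K) (f : L1 E) :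
    Summable fun i => ‖T i (f i)‖ :=
  ((summable_norm f).mul_left K).of_nonneg_of_le (fun _ => norm_nonneg _)
    fun i => (T i).le_of_opNorm_le (hT i) _

/-! ### Bounded families of maps extend to ℓ¹ -/

section lift

variable [CompleteSpace F]

/-- The continuous linear map `f ↦ ∑ i, T i (f i)` on `ℓ¹`, for a bounded family `T`. -/
def lift (T : ℕ → E →L[ℂ] F) {K : ℝ} (_hK : 0 ≤ K) (hT : ∀ i, ‖T i‖ ≤ K) : L1 E →L[ℂ] F :=
  LinearMap.mkContinuous
    { toFun := fun f => ∑' i, T i (f i)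
      map_add' := fun f g => by
        rw [← Summable.tsum_add (summable_norm_map T hT f).of_norm
          (summable_norm_map T hT g).of_norm]
        simp
      map_smul' := fun c f => by
        rw [RingHom.id_apply, ← Summable.tsum_const_smul _ (summable_norm_map T hT f).of_norm]
        simp }
    K fun f => by
      rw [norm_eq, ← tsum_mul_left]
      exact (norm_tsum_le_tsum_norm (summable_norm_map T hT f)).trans
        ((summable_norm_map T hT f).tsum_le_tsum (fun i => (T i).le_of_opNorm_le (hT i) _)
          ((summable_norm f).mul_left K))

theorem lift_apply (T : ℕ → E →L[ℂ] F) {K : ℝ} (hK : 0 ≤ K) (hT : ∀ i, ‖T i‖ ≤ K) (f : L1 E) :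
    lift T hK hT f = ∑' i, T i (f i) := rfl

theorem lift_single (T : ℕ → E →L[ℂ] F) {K : ℝ} (hK : 0 ≤ K) (hT : ∀ i, ‖T i‖ ≤ K)
    (i : ℕ) (x : E) : lift T hK hT (single i x) = T i x := by
  rw [lift_apply, tsum_eq_single i]
  · rw [single_apply_self]
  · intro j hj
    rw [single_apply, if_neg hj, map_zero]

theorem norm_lift_le (T : ℕ → E →L[ℂ] F) {K : ℝ} (hK : 0 ≤ K) (hT : ∀ i, ‖T i‖ ≤ K) :
    ‖lift T hK hT‖ ≤ K :=
  LinearMap.mkContinuous_norm_le _ hK _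

end lift

variable [CompleteSpace E]

variable (E) in
/-- The right shift on `ℓ¹`. -/
def shiftUp : L1 E →L[ℂ] L1 E :=
  lift (fun i => singleL E (i + 1)) zero_le_one fun _ => norm_singleL_le _

variable (E) in
/-- The family of maps that defines the left shift. -/
def shiftDownAux : ℕ → E →L[ℂ] L1 E
  | 0 => 0
  | i + 1 => singleL E i

omit [CompleteSpace E] in
theorem norm_shiftDownAux_le : ∀ i : ℕ, ‖shiftDownAux E i‖ ≤ 1
  | 0 => by simp [shiftDownAux]
  | i + 1 => norm_singleL_le i

variable (E) in
/-- The left shift on `ℓ¹`. -/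
def shiftDown : L1 E →L[ℂ] L1 E := lift (shiftDownAux E) zero_le_one norm_shiftDownAux_le

@[simp] theorem shiftUp_single (i : ℕ) (x : E) : shiftUp E (single i x) = single (i + 1) x :=
  lift_single _ _ _ _ _

@[simp] theorem shiftDown_single_zero (x : E) : shiftDown E (single 0 x) = 0 :=
  lift_single _ _ _ _ _

@[simp] theorem shiftDown_single_succ (i : ℕ) (x : E) :
    shiftDown E (single (i + 1) x) = single i x :=
  lift_single _ _ _ _ _

@[simp] theorem shiftUp_apply_zero (f : L1 E) : shiftUp E f 0 = 0 := by
  have : (eval E 0).comp (shiftUp E) = 0 := clm_ext fun i x => by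
    simp [single_apply]
  exact DFunLike.congr_fun this f

@[simp] theorem shiftUp_apply_succ (f : L1 E) (j : ℕ) : shiftUp E f (j + 1) = f j := by
  have : (eval E (j + 1)).comp (shiftUp E) = eval E j := clm_ext fun i x => by
    simp [single_apply]
  exact DFunLike.congr_fun this f

@[simp] theorem shiftDown_apply (f : L1 E) (j : ℕ) : shiftDown E f j = f (j + 1) := by
  have : (eval E j).comp (shiftDown E) = eval E (j + 1) := clm_ext fun i x => by
    rcases i with _ | i <;> simp [single_apply]
  exact DFunLike.congr_fun this f

end L1

/-! ### Matrices with absolutely summable entries -/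

/-- Absolutely summable complex sequences. -/
abbrev Seq : Type := L1 ℂ

/-- Matrices over `ℕ × ℕ` with absolutely summable entries, stored as the sequence of their
columns: `A j i` is the entry in row `i` and column `j`. -/
abbrev TrMat : Type := L1 Seq

/-- The standard basis of `Seq`. -/
def basisVec (i : ℕ) : Seq := L1.single i 1

theorem basisVec_apply (i j : ℕ) : basisVec i j = if j = i then 1 else 0 :=
  L1.single_apply _ _ _

theorem norm_basisVec (i : ℕ) : ‖basisVec i‖ = 1 := by
  rw [basisVec, L1.norm_single, norm_one]

theorem single_eq_smul_basisVec (i : ℕ) (c : ℂ) : (L1.single i c : Seq) = c • basisVec i := by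
  rw [basisVec, ← L1.singleL_apply, ← L1.singleL_apply, ← map_smul, smul_eq_mul, mul_one]

theorem seq_clm_ext {F : Type*} [NormedAddCommGroup F] [NormedSpace ℂ F] {T U : Seq →L[ℂ] F}
    (h : ∀ i, T (basisVec i) = U (basisVec i)) : T = U :=
  L1.clm_ext fun i x => by rw [single_eq_smul_basisVec, map_smul, map_smul, h]

theorem trMat_ext {A B : TrMat} (h : ∀ j i, A j i = B j i) : A = B :=
  L1.ext fun j => L1.ext fun i => h j i

/-- The coordinate functionals on `Seq`. -/
abbrev coord (i : ℕ) : Seq →L[ℂ] ℂ := L1.eval ℂ i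

/-- The trace. -/
def tr : TrMat →L[ℂ] ℂ := L1.lift coord zero_le_one L1.norm_eval_le

theorem tr_apply (A : TrMat) : tr A = ∑' j, A j j := rfl

theorem summable_diag (A : TrMat) : Summable fun j => A j j :=
  (L1.summable_norm_map coord L1.norm_eval_le A).of_norm

theorem norm_tr_le (A : TrMat) : ‖tr A‖ ≤ ‖A‖ := by
  simpa using tr.le_of_opNorm_le (L1.norm_lift_le _ zero_le_one L1.norm_eval_le) A

/-- The operator on sequences that is given by a matrix. -/
def op : TrMat →L[ℂ] Seq →L[ℂ] Seq :=
  L1.lift (fun j => ContinuousLinearMap.smulRightL ℂ Seq Seq (coord j)) zero_le_one fun j =>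
    ContinuousLinearMap.opNorm_le_bound _ zero_le_one fun x => by
      rw [one_mul]
      exact (ContinuousLinearMap.norm_smulRight_apply _ _).trans_le
        (mul_le_of_le_one_left (norm_nonneg x) (L1.norm_eval_le j))

theorem op_single (i : ℕ) (y x : Seq) : op (L1.single i y) x = x i • y := by
  rw [op, L1.lift_single]
  rfl

@[simp] theorem op_basisVec (A : TrMat) (j : ℕ) : op A (basisVec j) = A j := by
  have : op.flip (basisVec j) = L1.eval Seq j := L1.clm_ext fun i y => by
    rw [ContinuousLinearMap.flip_apply, op_single, basisVec_apply, L1.eval_apply, L1.single_apply]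
    by_cases h : i = j
    · subst h; simp
    · simp [h, Ne.symm h]
  exact DFunLike.congr_fun this A

theorem norm_op_le (A : TrMat) : ‖op A‖ ≤ ‖A‖ := by
  have : ‖op‖ ≤ 1 := L1.norm_lift_le _ zero_le_one _
  simpa using op.le_of_opNorm_le this A

/-- The linear map `x ↦ (T ↦ T x)`, with `T x` regarded as the `j`-th column of a matrix. -/
def evalColumn (j : ℕ) : Seq →L[ℂ] (Seq →L[ℂ] Seq) →L[ℂ] TrMat :=
  (ContinuousLinearMap.compL ℂ (Seq →L[ℂ] Seq) Seq TrMat (L1.singleL Seq j)).comp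
    (ContinuousLinearMap.apply ℂ Seq)

theorem evalColumn_apply (j : ℕ) (x : Seq) (T : Seq →L[ℂ] Seq) :
    evalColumn j x T = L1.single j (T x) := rfl

theorem norm_evalColumn_le (j : ℕ) : ‖evalColumn j‖ ≤ 1 :=
  ContinuousLinearMap.opNorm_le_bound _ zero_le_one fun x =>
    ContinuousLinearMap.opNorm_le_bound _ (mul_nonneg zero_le_one (norm_nonneg x)) fun T => by
      rw [evalColumn_apply, L1.norm_single, one_mul, mul_comm]
      exact T.le_opNorm x

/-- The product of an operator with a matrix. -/
def lmul : (Seq →L[ℂ] Seq) →L[ℂ] TrMat →L[ℂ] TrMat :=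
  ContinuousLinearMap.flip (L1.lift evalColumn zero_le_one norm_evalColumn_le)

theorem lmul_single (T : Seq →L[ℂ] Seq) (j : ℕ) (x : Seq) :
    lmul T (L1.single j x) = L1.single j (T x) := by
  rw [lmul, ContinuousLinearMap.flip_apply, L1.lift_single]
  rfl

@[simp] theorem lmul_apply (T : Seq →L[ℂ] Seq) (A : TrMat) (j : ℕ) : lmul T A j = T (A j) := by
  have : (L1.eval Seq j).comp (lmul T) = T.comp (L1.eval Seq j) := L1.clm_ext fun i y => by
    rw [ContinuousLinearMap.comp_apply, ContinuousLinearMap.comp_apply, lmul_single, L1.eval_apply,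
      L1.eval_apply, L1.single_apply, L1.single_apply]
    split_ifs with h
    · rfl
    · rw [map_zero]
  exact DFunLike.congr_fun this A

theorem lmul_one (A : TrMat) : lmul 1 A = A :=
  L1.ext fun j => by rw [lmul_apply, one_apply_eq_self]

theorem lmul_mul (T U : Seq →L[ℂ] Seq) (A : TrMat) : lmul (T * U) A = lmul T (lmul U A) :=
  L1.ext fun j => by simp only [lmul_apply, mul_apply_eq_comp]

theorem op_lmul (T : Seq →L[ℂ] Seq) (A : TrMat) : op (lmul T A) = T * op A :=
  seq_clm_ext fun i => by
    rw [op_basisVec, lmul_apply, mul_apply_eq_comp, op_basisVec]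

/-! ### The determinant of `1 + A` for a matrix `A` with absolutely summable entries -/

theorem hasSum_pi_prod {k : ℕ} {f : Fin k → ℕ → ℝ} {a : Fin k → ℝ} (h0 : ∀ p n, 0 ≤ f p n)
    (hf : ∀ p, HasSum (f p) (a p)) :
    HasSum (fun i : Fin k → ℕ => ∏ p, f p (i p)) (∏ p, a p) := by
  induction k with
  | zero => simp
  | succ k ih =>
    rw [← (Fin.consEquiv fun _ : Fin (k + 1) => ℕ).hasSum_iff, Fin.prod_univ_succ]
    have h1 := ih (f := fun p => f p.succ) (a := fun p => a p.succ) (fun p => h0 p.succ)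
      fun p => hf p.succ
    have hs : Summable fun x : ℕ × (Fin k → ℕ) => f 0 x.1 * ∏ p : Fin k, f p.succ (x.2 p) :=
      Summable.mul_of_nonneg (f := f 0) (g := fun i : Fin k → ℕ => ∏ p : Fin k, f p.succ (i p))
        (hf 0).summable h1.summable (h0 0)
        fun i => Finset.prod_nonneg fun p _ => h0 p.succ (i p)
    have h2 := (hf 0).mul h1 hs
    refine h2.congr_fun ?_
    intro x
    simp [Fin.prod_univ_succ, Fin.consEquiv]

/-- The determinant with entries `(A p) (i q, i p)`, as a multilinear function of the matrices
`A p`. -/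
def minorMap (k : ℕ) (i : Fin k → ℕ) : MultilinearMap ℂ (fun _ : Fin k => TrMat) ℂ :=
  (Matrix.detRowAlternating (R := ℂ) (n := Fin k)).toMultilinearMap.compLinearMap fun p =>
    LinearMap.pi fun q => ((coord (i q)).comp (L1.eval Seq (i p)) : TrMat →L[ℂ] ℂ).toLinearMap

theorem minorMap_apply {k : ℕ} (i : Fin k → ℕ) (A : Fin k → TrMat) :
    minorMap k i A = Matrix.det (Matrix.of fun p q => A p (i p) (i q)) := rfl

/-- The Leibniz formula runs over permutations only, whereas the expanded product runs over all
maps. -/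
theorem norm_det_le_prod_sum {k : ℕ} (M : Matrix (Fin k) (Fin k) ℂ) :
    ‖M.det‖ ≤ ∏ p, ∑ q, ‖M p q‖ := by
  rw [← Matrix.det_transpose, Matrix.det_apply, Finset.prod_univ_sum, Fintype.piFinset_univ]
  refine (norm_sum_le _ _).trans ?_
  refine le_trans (b := ∑ σ : Equiv.Perm (Fin k), ∏ p, ‖M p (σ p)‖) ?_ ?_
  · refine Finset.sum_le_sum fun σ _ => ?_
    rcases Int.units_eq_one_or (Equiv.Perm.sign σ) with h | h <;> simp [h]
  · rw [← Finset.sum_image (s := Finset.univ) (g := fun σ : Equiv.Perm (Fin k) => (σ : Fin k → Fin k))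
      (f := fun g => ∏ p, ‖M p (g p)‖) (fun σ _ τ _ h => DFunLike.coe_injective h)]
    exact Finset.sum_le_sum_of_subset_of_nonneg (Finset.subset_univ _)
      fun g _ _ => Finset.prod_nonneg fun _ _ => norm_nonneg _

/-- For injective `i`, the entries in row `p` of the minor are distinct entries of one column of `A
p`, so their sum is at most the norm of that column. A repeated index gives two equal columns. There
is no factor `k!`, which is why the determinant series is entire. -/
theorem norm_minorMap_le {k : ℕ} (i : Fin k → ℕ) (A : Fin k → TrMat) :
    ‖minorMap k i A‖ ≤ ∏ p, ‖A p (i p)‖ := by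
  rw [minorMap_apply]
  by_cases hi : Function.Injective i
  · refine (norm_det_le_prod_sum _).trans
      (Finset.prod_le_prod (fun _ _ => Finset.sum_nonneg fun _ _ => norm_nonneg _) fun p _ => ?_)
    rw [L1.norm_eq]
    have := Finset.sum_image (s := Finset.univ) (g := i) (f := fun l => ‖A p (i p) l‖)
      fun _ _ _ _ h => hi h
    simp only [Matrix.of_apply]
    rw [← this]
    exact (L1.summable_norm (A p (i p))).sum_le_tsum _ fun _ _ => norm_nonneg _
  · simp only [Function.Injective, not_forall] at hi
    obtain ⟨q, q', h, hne⟩ := hi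
    rw [Matrix.det_zero_of_column_eq hne (fun p => by simp [h]), norm_zero]
    exact Finset.prod_nonneg fun _ _ => norm_nonneg _

theorem hasSum_prod_norm_column {k : ℕ} (A : Fin k → TrMat) :
    HasSum (fun i : Fin k → ℕ => ∏ p, ‖A p (i p)‖) (∏ p, ‖A p‖) :=
  hasSum_pi_prod (f := fun p n => ‖A p n‖) (a := fun p => ‖A p‖) (fun _ _ => norm_nonneg _)
    fun p => by
      rw [L1.norm_eq]; exact (L1.summable_norm (A p)).hasSum

theorem summable_norm_minorMap {k : ℕ} (A : Fin k → TrMat) :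
    Summable fun i : Fin k → ℕ => ‖minorMap k i A‖ :=
  (hasSum_prod_norm_column A).summable.of_nonneg_of_le (fun _ => norm_nonneg _)
    fun i => norm_minorMap_le i A

/-- The sum of all the determinants `minorMap k i`. -/
def minorSum (k : ℕ) : ContinuousMultilinearMap ℂ (fun _ : Fin k => TrMat) ℂ :=
  MultilinearMap.mkContinuous
    { toFun := fun A => ∑' i, minorMap k i A
      map_update_add' := fun A p X Y => by
        rw [← (summable_norm_minorMap _).of_norm.tsum_add (summable_norm_minorMap _).of_norm]
        refine tsum_congr fun i => ?_
        convert (minorMap k i).map_update_add A p X Y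
      map_update_smul' := fun A p c X => by
        rw [← (summable_norm_minorMap _).of_norm.tsum_const_smul]
        refine tsum_congr fun i => ?_
        convert (minorMap k i).map_update_smul A p c X }
    1 fun A => by
      rw [one_mul]
      refine (norm_tsum_le_tsum_norm (summable_norm_minorMap A)).trans ?_
      rw [← (hasSum_prod_norm_column A).tsum_eq]
      exact (summable_norm_minorMap A).tsum_le_tsum (fun i => norm_minorMap_le i A)
        (hasSum_prod_norm_column A).summable

theorem minorSum_apply {k : ℕ} (A : Fin k → TrMat) : minorSum k A = ∑' i, minorMap k i A := rfl

theorem norm_minorSum_le (k : ℕ) : ‖minorSum k‖ ≤ 1 :=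
  MultilinearMap.mkContinuous_norm_le _ zero_le_one _

/-- The expansion of `det (1 + A)` in powers of `A`. -/
def detSeries : FormalMultilinearSeries ℂ TrMat ℂ := fun k => ((k.factorial : ℂ)⁻¹) • minorSum k

theorem norm_detSeries_le (k : ℕ) : ‖detSeries k‖ ≤ (k.factorial : ℝ)⁻¹ := by
  rw [detSeries, norm_smul, norm_inv, Complex.norm_natCast]
  exact mul_le_of_le_one_right (by positivity) (norm_minorSum_le k)

theorem radius_detSeries : detSeries.radius = ⊤ :=
  detSeries.radius_eq_top_of_summable_norm fun r =>
    (Real.summable_pow_div_factorial r).of_nonneg_of_le (fun _ => by positivity) fun k => by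
      rw [div_eq_inv_mul]
      gcongr
      exact norm_detSeries_le k

/-- The determinant of `1 + A`. -/
def detOne (A : TrMat) : ℂ := detSeries.sum A

theorem hasFPowerSeriesOnBall_detOne : HasFPowerSeriesOnBall detOne detSeries 0 ⊤ := by
  rw [← radius_detSeries]
  exact detSeries.hasFPowerSeriesOnBall (by simp [radius_detSeries])

theorem detOne_apply (A : TrMat) :
    detOne A = ∑' k, ((k.factorial : ℂ)⁻¹) * ∑' i : Fin k → ℕ, minorMap k i fun _ => A := rfl

theorem contDiff_detOne {n : WithTop ℕ∞} : ContDiff ℂ n detOne := by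
  have : AnalyticOnNhd ℂ detOne Set.univ := by
    simpa using hasFPowerSeriesOnBall_detOne.analyticOnNhd
  exact contDiffOn_univ.1 (this.contDiffOn uniqueDiffOn_univ)

theorem detOne_zero : detOne 0 = 1 := by
  have := hasFPowerSeriesOnBall_detOne.coeff_zero (fun _ => 0)
  rw [← this, detSeries, smul_apply, minorSum_apply]
  simp [minorMap_apply, tsum_fintype]

theorem fderiv_detOne_zero : fderiv ℂ detOne 0 = tr := by
  rw [hasFPowerSeriesOnBall_detOne.hasFPowerSeriesAt.fderiv_eq]
  ext A
  rw [continuousMultilinearCurryFin1_apply, detSeries, smul_apply,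
    minorSum_apply, tr_apply, ← (Equiv.funUnique (Fin 1) ℕ).symm.tsum_eq]
  simp [minorMap_apply]

theorem hasFDerivAt_detOne_zero : HasFDerivAt detOne tr 0 := by
  rw [← fderiv_detOne_zero]
  exact (contDiff_detOne.differentiable one_ne_zero).differentiableAt.hasFDerivAt

/-! ### Multiplicativity of the determinant -/

/-- A finite square matrix, extended by zero. -/
def ofMat {N : ℕ} (X : Matrix (Fin N) (Fin N) ℂ) : TrMat :=
  ∑ j : Fin N, L1.single (j : ℕ) (∑ i : Fin N, L1.single (i : ℕ) (X i j))

theorem L1.sum_apply {E ι : Type*} [NormedAddCommGroup E] [NormedSpace ℂ E] (s : Finset ι)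
    (f : ι → L1 E) (j : ℕ) : (∑ i ∈ s, f i) j = ∑ i ∈ s, f i j :=
  map_sum (L1.eval E j) f s

theorem ofMat_apply {N : ℕ} (X : Matrix (Fin N) (Fin N) ℂ) (j i : ℕ) :
    ofMat X j i = if h : j < N ∧ i < N then X ⟨i, h.2⟩ ⟨j, h.1⟩ else 0 := by
  have h1 : ofMat X j = ∑ j' : Fin N, if j = j' then ∑ i : Fin N, L1.single (i : ℕ) (X i j') else 0 := by
    simp only [ofMat, L1.sum_apply, L1.single_apply]
  rw [h1]
  by_cases hj : j < N
  · rw [Finset.sum_eq_single ⟨j, hj⟩ (fun b _ hb => if_neg fun h => hb (Fin.ext h.symm)) (by simp),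
      if_pos rfl, L1.sum_apply]
    simp only [L1.single_apply]
    by_cases hi : i < N
    · rw [Finset.sum_eq_single ⟨i, hi⟩ (fun b _ hb => if_neg fun h => hb (Fin.ext h.symm)) (by simp),
        if_pos rfl, dif_pos ⟨hj, hi⟩]
    · rw [dif_neg fun h => hi h.2]
      exact Finset.sum_eq_zero fun b _ => if_neg fun h : i = (b : ℕ) => hi (h ▸ b.2)
  · rw [dif_neg fun h => hj h.1, Finset.sum_eq_zero fun (b : Fin N) _ =>
      if_neg fun h : j = (b : ℕ) => hj (h ▸ b.2)]
    rfl

theorem ofMat_add {N : ℕ} (X Y : Matrix (Fin N) (Fin N) ℂ) : ofMat (X + Y) = ofMat X + ofMat Y :=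
  trMat_ext fun j i => by
    simp only [L1.add_apply, ofMat_apply]
    split_ifs <;> simp

theorem op_apply_apply (A : TrMat) (x : Seq) (i : ℕ) : op A x i = ∑' j, x j * A j i := by
  have h := (((L1.hasSum_single x).mapL (op A)).mapL (coord i)).tsum_eq
  rw [← L1.eval_apply, ← h]
  exact tsum_congr fun j => by
    rw [single_eq_smul_basisVec, map_smul, op_basisVec, map_smul, L1.eval_apply, smul_eq_mul]

theorem lmul_op_ofMat {N : ℕ} (X Y : Matrix (Fin N) (Fin N) ℂ) :
    lmul (op (ofMat X)) (ofMat Y) = ofMat (X * Y) := trMat_ext fun j i => by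
  rw [lmul_apply, op_apply_apply, tsum_eq_sum (s := Finset.range N), ofMat_apply]
  · split_ifs with h
    · rw [Finset.sum_range, Matrix.mul_apply]
      exact Finset.sum_congr rfl fun l _ => by
        rw [ofMat_apply, ofMat_apply, dif_pos ⟨h.1, l.2⟩, dif_pos ⟨l.2, h.2⟩, mul_comm]
    · refine Finset.sum_eq_zero fun l _ => ?_
      simp only [ofMat_apply]
      by_cases hj : j < N
      · rw [dif_neg (fun h' : l < N ∧ i < N => h ⟨hj, h'.2⟩), mul_zero]
      · rw [dif_neg (fun h' : j < N ∧ l < N => hj h'.1), zero_mul]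
  · intro l hl
    rw [ofMat_apply, dif_neg (fun h => hl (Finset.mem_range.2 h.2)), zero_mul]

/-- Tuples with a repetition contribute zero, and each `k`-subset has `k!` enumerations, all with
the same principal minor. -/
theorem sum_det_submatrix {N : ℕ} (X : Matrix (Fin N) (Fin N) ℂ) (k : ℕ) :
    ∑ i : Fin k → Fin N, (X.submatrix i i).det =
      k.factorial * ∑ s ∈ Finset.univ.powersetCard k,
        (X.submatrix (Subtype.val : s → Fin N) (Subtype.val : s → Fin N)).det := by
  have h := Finset.sum_of_injOn
    (s := (Finset.univ.powersetCard k).sigma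
      fun s : Finset (Fin N) => (Finset.univ : Finset (Fin k ≃ s)))
    (t := (Finset.univ : Finset (Fin k → Fin N)))
    (f := fun x => (X.submatrix (Subtype.val : x.1 → Fin N) (Subtype.val : x.1 → Fin N)).det)
    (g := fun i => (X.submatrix i i).det) (fun x p => (x.2 p : Fin N)) ?_ ?_ ?_ ?_
  · rw [← h, Finset.sum_sigma, Finset.mul_sum]
    refine Finset.sum_congr rfl fun s hs => ?_
    have hc : Fintype.card (Fin k) = Fintype.card s := by
      rw [Fintype.card_fin, Fintype.card_coe, (Finset.mem_powersetCard.1 hs).2]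
    trans ∑ _e : Fin k ≃ s, (X.submatrix (Subtype.val : s → Fin N) (Subtype.val : s → Fin N)).det
    · rfl
    rw [Finset.sum_const, Finset.card_univ, Fintype.card_equiv (Fintype.equivOfCardEq hc),
      Fintype.card_fin, nsmul_eq_mul]
  · rintro ⟨s, e⟩ _ ⟨s', e'⟩ _ hee
    have hp : ∀ p, (e p : Fin N) = e' p := fun p => congrFun hee p
    have hs : s = s' := by
      ext a
      constructor
      · intro ha
        have := (e' (e.symm ⟨a, ha⟩)).2
        rwa [← hp, e.apply_symm_apply] at this
      · intro ha
        have := (e (e'.symm ⟨a, ha⟩)).2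
        rwa [hp, e'.apply_symm_apply] at this
    subst hs
    congr 1
    ext p
    rw [hp]
  · intro _ _
    simp
  · intro i _ hi
    by_cases hinj : Function.Injective i
    · refine absurd ?_ hi
      let s := Finset.univ.image i
      have hmem : ∀ p, i p ∈ s := fun p => Finset.mem_image_of_mem i (Finset.mem_univ p)
      let e : Fin k ≃ s := Equiv.ofBijective (fun p => ⟨i p, hmem p⟩)
        ⟨fun p q h => hinj (congrArg Subtype.val h), fun ⟨a, ha⟩ => by
          obtain ⟨p, -, hp⟩ := Finset.mem_image.1 ha
          exact ⟨p, Subtype.ext hp⟩⟩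
      refine ⟨⟨s, e⟩, ?_, rfl⟩
      simp [s, Finset.mem_powersetCard, Finset.card_image_of_injective _ hinj]
    · simp only [Function.Injective, not_forall] at hinj
      obtain ⟨q, q', h, hne⟩ := hinj
      exact Matrix.det_zero_of_column_eq hne fun p => by simp [h]
  · rintro ⟨s, e⟩ _
    exact (Matrix.det_submatrix_equiv_self e _).symm

theorem tsum_minorMap_ofMat {N : ℕ} (X : Matrix (Fin N) (Fin N) ℂ) (k : ℕ) :
    ∑' i : Fin k → ℕ, minorMap k i (fun _ => ofMat X) =
      ∑ i : Fin k → Fin N, (X.submatrix i i).det := by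
  have hinj : Function.Injective fun (i : Fin k → Fin N) (p : Fin k) => (i p : ℕ) :=
    fun i i' h => funext fun p => Fin.ext (congrFun h p)
  rw [← hinj.tsum_eq, tsum_fintype]
  · refine Finset.sum_congr rfl fun i _ => ?_
    rw [minorMap_apply, ← Matrix.det_transpose]
    congr 1
    ext p q
    simp [ofMat_apply]
  · intro i hi
    by_contra hr
    obtain ⟨p, hp⟩ : ∃ p, ¬ i p < N := by
      by_contra hall
      push Not at hall
      exact hr ⟨fun p => ⟨i p, hall p⟩, rfl⟩
    refine hi ((minorMap_apply _ _).trans (Matrix.det_eq_zero_of_row_eq_zero p fun q => ?_))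
    rw [Matrix.of_apply, ofMat_apply, dif_neg fun h => hp h.1]

/-- The coefficient of `t^k` in `det(1+tX)` is the sum of the principal minors of size `k`; the
series is this polynomial at `t = 1`. -/
theorem detOne_ofMat {N : ℕ} (X : Matrix (Fin N) (Fin N) ℂ) : detOne (ofMat X) = (1 + X).det := by
  let P : Polynomial ℂ := (1 + (Polynomial.X : Polynomial ℂ) • X.map Polynomial.C).det
  have h1 : ∀ k, ((k.factorial : ℂ)⁻¹) * ∑' i : Fin k → ℕ, minorMap k i (fun _ => ofMat X)
      = P.coeff k := fun k => by
    rw [tsum_minorMap_ofMat, sum_det_submatrix, ← mul_assoc,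
      inv_mul_cancel₀ (Nat.cast_ne_zero.2 k.factorial_ne_zero), one_mul,
      Matrix.coeff_det_one_add_X_smul_eq_sum_minors]
  rw [detOne_apply, tsum_congr h1, tsum_eq_sum (s := Finset.range (P.natDegree + 1))]
  · have h2 := P.eval_eq_sum_range 1
    simp only [one_pow, mul_one] at h2
    rw [← h2, ← Polynomial.coe_evalRingHom, RingHom.map_det]
    congr 1
    ext i j
    simp [Matrix.one_apply, apply_ite]
  · intro k hk
    exact Polynomial.coeff_eq_zero_of_natDegree_lt (by simpa using hk)

/-- The upper left corner of a matrix. -/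
def corner (N : ℕ) (A : TrMat) : Matrix (Fin N) (Fin N) ℂ := Matrix.of fun i j => A j i

theorem sub_corner_apply (N : ℕ) (A : TrMat) (j i : ℕ) :
    (A - ofMat (corner N A)) j i = if j < N ∧ i < N then 0 else A j i := by
  rw [L1.sub_apply, L1.sub_apply, ofMat_apply]
  split_ifs <;> simp [corner]

/-- Dominated convergence is used twice: within each column, then over the columns. -/
theorem tendsto_corner (A : TrMat) : Tendsto (fun N => ofMat (corner N A)) atTop (𝓝 A) := by
  have hle : ∀ N j i, ‖(A - ofMat (corner N A)) j i‖ ≤ ‖A j i‖ := fun N j i => by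
    rw [sub_corner_apply]; split_ifs <;> simp
  have h1 : ∀ j, Tendsto (fun N => ‖(A - ofMat (corner N A)) j‖) atTop (𝓝 0) := fun j => by
    simp only [L1.norm_eq ((A - ofMat (corner _ A)) j)]
    rw [← tsum_zero (α := ℝ) (β := ℕ)]
    refine tendsto_tsum_of_dominated_convergence (L1.summable_norm (A j)) (fun i => ?_)
      (Eventually.of_forall fun N i => by rw [norm_norm]; exact hle N j i)
    refine tendsto_const_nhds.congr' ?_
    filter_upwards [eventually_gt_atTop j, eventually_gt_atTop i] with N h h'
    rw [sub_corner_apply, if_pos ⟨h, h'⟩, norm_zero]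
  have h2 : Tendsto (fun N => ‖A - ofMat (corner N A)‖) atTop (𝓝 0) := by
    simp only [L1.norm_eq (A - ofMat (corner _ A))]
    rw [← tsum_zero (α := ℝ) (β := ℕ)]
    refine tendsto_tsum_of_dominated_convergence (L1.summable_norm A) h1
      (Eventually.of_forall fun N j => ?_)
    rw [norm_norm, L1.norm_eq, L1.norm_eq]
    exact Summable.tsum_le_tsum (fun i => hle N j i) (L1.summable_norm _) (L1.summable_norm _)
  rw [tendsto_iff_norm_sub_tendsto_zero]
  simpa only [norm_sub_rev] using h2

theorem continuous_detOne : Continuous detOne :=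
  (contDiff_detOne (n := 1)).continuous

/-- The argument on the left is `(1+A)(1+B) - 1`. Both sides are continuous, so the finite product
formula passes to the limit along upper left corners. -/
theorem detOne_mul (A B : TrMat) : detOne (A + lmul (1 + op A) B) = detOne A * detOne B := by
  have hA := tendsto_corner A
  have hB := tendsto_corner B
  have h1 : Tendsto (fun N => detOne (ofMat (corner N A)
      + lmul (1 + op (ofMat (corner N A))) (ofMat (corner N B)))) atTop
      (𝓝 (detOne (A + lmul (1 + op A) B))) := by
    have hop : Tendsto (fun N => 1 + op (ofMat (corner N A))) atTop (𝓝 (1 + op A)) :=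
      tendsto_const_nhds.add ((op.continuous.tendsto A).comp hA)
    have hl : Tendsto (fun N => lmul (1 + op (ofMat (corner N A))) (ofMat (corner N B))) atTop
        (𝓝 (lmul (1 + op A) B)) :=
      (isBoundedBilinearMap_apply.continuous.tendsto (lmul (1 + op A), B)).comp
        (((lmul.continuous.tendsto _).comp hop).prodMk_nhds hB)
    exact (continuous_detOne.tendsto _).comp (hA.add hl)
  have h2 : Tendsto (fun N => detOne (ofMat (corner N A)) * detOne (ofMat (corner N B))) atTop
      (𝓝 (detOne A * detOne B)) :=
    ((continuous_detOne.tendsto _).comp hA).mul ((continuous_detOne.tendsto _).comp hB)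
  refine tendsto_nhds_unique (h1.congr fun N => ?_) h2
  rw [map_add, add_apply, lmul_one, lmul_op_ofMat, ← ofMat_add, ← ofMat_add,
    detOne_ofMat, detOne_ofMat, detOne_ofMat, ← Matrix.det_mul]
  congr 1
  noncomm_ring

/-! ### Special values of the determinant -/

/-- The shifts prepend a zero row and a zero column; a minor that uses the new index has a zero row.
-/
theorem detOne_shift (A : TrMat) :
    detOne (L1.shiftUp Seq (lmul (L1.shiftUp ℂ) A)) = detOne A := by
  rw [detOne_apply, detOne_apply]
  refine tsum_congr fun k => ?_
  congr 1
  have hinj : Function.Injective fun (i : Fin k → ℕ) (p : Fin k) => i p + 1 :=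
    fun i i' h => funext fun p => Nat.succ_injective (congrFun h p)
  rw [← hinj.tsum_eq]
  · exact tsum_congr fun i => by simp [minorMap_apply]
  · intro i hi
    by_contra hr
    obtain ⟨p, hp⟩ : ∃ p, i p = 0 := by
      by_contra hall
      push Not at hall
      exact hr ⟨fun p => i p - 1, funext fun p => Nat.sub_add_cancel (Nat.pos_of_ne_zero (hall p))⟩
    refine hi ((minorMap_apply _ _).trans (Matrix.det_eq_zero_of_row_eq_zero p fun q => ?_))
    rw [Matrix.of_apply, hp, L1.shiftUp_apply_zero, L1.zero_apply]

theorem detOne_of_rank_one {A : TrMat} (x : Seq) (f : ℕ → ℂ) (hA : ∀ j, A j = f j • x) :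
    detOne A = 1 + tr A := by
  have h2 : ∀ k, 2 ≤ k → ∀ i : Fin k → ℕ, minorMap k i (fun _ => A) = 0 := fun k hk i => by
    have : Nontrivial (Fin k) := Fin.nontrivial_iff_two_le.2 hk
    rw [minorMap_apply, ← Matrix.det_vecMulVec (fun p => f (i p)) fun q => x (i q)]
    congr 1
    ext p q
    simp [hA, Matrix.vecMulVec_apply]
  rw [detOne_apply, tsum_eq_sum (s := Finset.range 2)]
  · rw [Finset.sum_range_succ, Finset.sum_range_one, tr_apply,
      ← (Equiv.funUnique (Fin 1) ℕ).symm.tsum_eq]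
    simp [minorMap_apply, tsum_fintype]
  · intro k hk
    rw [tsum_congr (h2 k (by simp at hk; omega)), tsum_zero, mul_zero]

theorem tr_single (j : ℕ) (y : Seq) : tr (L1.single j y) = y j := L1.lift_single _ _ _ _ _

theorem detOne_single (j : ℕ) (y : Seq) : detOne (L1.single j y) = 1 + y j := by
  rw [detOne_of_rank_one y (fun i => if i = j then 1 else 0), tr_single]
  intro i
  rw [L1.single_apply]
  split_ifs <;> simp

/-! ### Derivatives of the determinant -/

/-- The inverse of `1 + A`. -/
def resolv (A : TrMat) : Seq →L[ℂ] Seq := Ring.inverse (1 + op A)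

theorem isUnit_one_add_op {A : TrMat} (hA : ‖A‖ < 1) : IsUnit (1 + op A) := by
  have h : ‖-op A‖ < 1 := by
    rw [norm_neg]; exact (norm_op_le A).trans_lt hA
  simpa using (Units.oneSub (-op A) h).isUnit

theorem one_add_op_mul_resolv {A : TrMat} (hA : IsUnit (1 + op A)) :
    (1 + op A) * resolv A = 1 := Ring.mul_inverse_cancel _ hA

theorem resolv_mul_one_add_op {A : TrMat} (hA : IsUnit (1 + op A)) :
    resolv A * (1 + op A) = 1 := Ring.inverse_mul_cancel _ hA

/-- This is the factorization `1 + A + H = (1+A)(1+RH)`. It moves differentiation at `A` to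
differentiation at zero, where the derivative is the trace. -/
theorem detOne_add {A : TrMat} (hA : IsUnit (1 + op A)) (H : TrMat) :
    detOne (A + H) = detOne A * detOne (lmul (resolv A) H) := by
  rw [← detOne_mul, ← lmul_mul, one_add_op_mul_resolv hA, lmul_one]

theorem hasFDerivAt_detOne {A : TrMat} (hA : IsUnit (1 + op A)) :
    HasFDerivAt detOne (detOne A • tr.comp (lmul (resolv A))) A := by
  have h1 : HasFDerivAt (fun B : TrMat => lmul (resolv A) (B - A)) (lmul (resolv A)) A :=
    (lmul (resolv A)).hasFDerivAt.comp A ((hasFDerivAt_id A).sub_const A)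
  have h2 : HasFDerivAt detOne tr (lmul (resolv A) (A - A)) := by
    rw [sub_self, map_zero]; exact hasFDerivAt_detOne_zero
  refine ((h2.comp A h1).const_mul (detOne A)).congr_of_eventuallyEq (Eventually.of_forall fun B => ?_)
  dsimp only
  rw [Function.comp_apply, ← detOne_add hA, add_sub_cancel]

theorem fderiv_detOne_apply {A : TrMat} (hA : IsUnit (1 + op A)) (H : TrMat) :
    fderiv ℂ detOne A H = detOne A * tr (lmul (resolv A) H) := by
  rw [(hasFDerivAt_detOne hA).fderiv]
  rfl

theorem hasFDerivAt_resolv {A : TrMat} (hA : IsUnit (1 + op A)) :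
    HasFDerivAt resolv
      ((-ContinuousLinearMap.mulLeftRight ℂ (Seq →L[ℂ] Seq) (resolv A) (resolv A)).comp op) A := by
  obtain ⟨u, hu⟩ := hA
  have h1 := hasFDerivAt_ringInverse (𝕜 := ℂ) u
  rw [← Ring.inverse_unit u, hu] at h1
  exact HasFDerivAt.comp A h1 (op.hasFDerivAt.const_add 1)

theorem fderiv_fderiv_detOne_apply {A : TrMat} (hA : IsUnit (1 + op A)) (H K : TrMat) :
    fderiv ℂ (fderiv ℂ detOne) A H K = detOne A * (tr (lmul (resolv A) H) * tr (lmul (resolv A) K)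
      - tr (lmul (resolv A * op H * resolv A) K)) := by
  have hd : DifferentiableAt ℂ (fderiv ℂ detOne) A :=
    ((contDiff_detOne (n := 2)).fderiv_right (m := 1) (by norm_num)).differentiable one_ne_zero A
  have h1 : HasFDerivAt (fun B => fderiv ℂ detOne B K)
      ((fderiv ℂ (fderiv ℂ detOne) A).flip K) A := by
    have := hd.hasFDerivAt.clm_apply (hasFDerivAt_const K A)
    simpa using this
  -- The formula for the first derivative holds only where `1 + B` is invertible; this set is open,
  -- so the formula can be differentiated, with `dR = -R dA R`.
  have hU : ∀ᶠ B in 𝓝 A, IsUnit (1 + op B) :=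
    (continuous_const.add op.continuous).continuousAt.preimage_mem_nhds (Units.isOpen.mem_nhds hA)
  have h2 : HasFDerivAt (fun B => detOne B * (tr.comp (lmul.flip K)) (resolv B)) _ A :=
    (hasFDerivAt_detOne hA).mul ((tr.comp (lmul.flip K)).hasFDerivAt.comp A (hasFDerivAt_resolv hA))
  have h3 := h2.congr_of_eventuallyEq (hU.mono fun B hB => by
    exact fderiv_detOne_apply hB K)
  have h4 := DFunLike.congr_fun (h1.unique h3) H
  rw [ContinuousLinearMap.flip_apply] at h4
  rw [h4]
  simp
  ring

/-! ### The determinant as the exponential of the trace of the logarithm -/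

theorem norm_op_pow_mul_le (A : TrMat) (m : ℕ) : ‖lmul (op A ^ m) A‖ ≤ ‖A‖ ^ (m + 1) := by
  induction m with
  | zero => simp [lmul_one]
  | succ m ih =>
    rw [pow_succ', lmul_mul, pow_succ' ‖A‖]
    have h1 : ‖lmul‖ ≤ 1 := by
      rw [lmul, ContinuousLinearMap.opNorm_flip]
      exact L1.norm_lift_le _ zero_le_one _
    refine (lmul.le_of_opNorm₂_le_of_le h1 (norm_op_le A) ih).trans ?_
    rw [one_mul]

theorem smul_op_eq (z : ℂ) (A : TrMat) : 1 + op (z • A) = 1 - (-z) • op A := by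
  rw [map_smul, neg_smul, sub_neg_eq_add]

theorem resolv_smul {z : ℂ} {A : TrMat} (hz : ‖z‖ * ‖A‖ < 1) :
    resolv (z • A) = ∑' m : ℕ, ((-z) • op A) ^ m := by
  have hlt : ‖(-z) • op A‖ < 1 := by
    rw [norm_smul, norm_neg]
    exact (mul_le_mul_of_nonneg_left (norm_op_le A) (norm_nonneg z)).trans_lt hz
  have h1 := mul_neg_geom_series _ hlt
  rw [← smul_op_eq] at h1
  have hU : IsUnit (1 + op (z • A)) := isUnit_one_add_op (by rwa [norm_smul])
  have h2 := congrArg (resolv (z • A) * ·) h1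
  simp only [mul_one] at h2
  rw [← mul_assoc, resolv_mul_one_add_op hU, one_mul] at h2
  exact h2.symm

theorem hasSum_tr_resolv_smul {z : ℂ} {A : TrMat} (hz : ‖z‖ * ‖A‖ < 1) :
    HasSum (fun m : ℕ => (-1) ^ m * tr (lmul (op A ^ m) A) * z ^ m)
      (tr (lmul (resolv (z • A)) A)) := by
  have hlt : ‖(-z) • op A‖ < 1 := by
    rw [norm_smul, norm_neg]
    exact (mul_le_mul_of_nonneg_left (norm_op_le A) (norm_nonneg z)).trans_lt hz
  have h := ((summable_geometric_of_norm_lt_one hlt).hasSum).mapL (tr.comp (lmul.flip A))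
  rw [← resolv_smul hz] at h
  refine h.congr_fun ?_
  intro m
  simp only [smul_pow, map_smul, ContinuousLinearMap.comp_apply, ContinuousLinearMap.flip_apply,
    smul_eq_mul]
  rw [neg_pow]
  ring

/-- The term of degree `m + 1` in the expansion of `tr (log (1 + z A))`. -/
def logTerm (A : TrMat) (m : ℕ) (z : ℂ) : ℂ :=
  (-1) ^ m / ((m : ℂ) + 1) * tr (lmul (op A ^ m) A) * z ^ (m + 1)

theorem hasDerivAt_logTerm (A : TrMat) (m : ℕ) (z : ℂ) :
    HasDerivAt (logTerm A m) ((-1) ^ m * tr (lmul (op A ^ m) A) * z ^ m) z := by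
  have h := (hasDerivAt_pow (m + 1) z).const_mul ((-1) ^ m / ((m : ℂ) + 1) * tr (lmul (op A ^ m) A))
  have hm : (m : ℂ) + 1 ≠ 0 := by exact_mod_cast m.succ_ne_zero
  refine h.congr_deriv ?_
  push_cast
  field_simp

/-- Both `det(1+zA)` and the exponential of the series have logarithmic derivative `tr((1+zA)⁻¹ A)`,
by the Neumann series. Their quotient is therefore constant, and it is `1` at `z = 0`. -/
theorem detOne_smul_eq_exp (A : TrMat) : ∀ᶠ z in 𝓝 (0 : ℂ), ∃ L : ℂ,
    HasSum (fun m : ℕ => logTerm A m z) L ∧ detOne (z • A) = Complex.exp L := by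
  set r : ℝ := (‖A‖ + 1)⁻¹ with hr
  have hr0 : 0 < r := by positivity
  have hrA : r * ‖A‖ < 1 := by
    rw [hr, inv_mul_lt_iff₀ (by positivity)]; linarith
  have hball : ∀ z ∈ Metric.ball (0 : ℂ) r, ‖z‖ * ‖A‖ < 1 := fun z hz =>
    (mul_le_mul_of_nonneg_right (by simpa using (Metric.mem_ball.1 hz).le)
      (norm_nonneg A)).trans_lt hrA
  have hu : Summable fun m : ℕ => ‖A‖ * (r * ‖A‖) ^ m :=
    (summable_geometric_of_lt_one (by positivity) hrA).mul_left _
  have hbd : ∀ (m : ℕ) (z : ℂ), z ∈ Metric.ball (0 : ℂ) r →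
      ‖(-1) ^ m * tr (lmul (op A ^ m) A) * z ^ m‖ ≤ ‖A‖ * (r * ‖A‖) ^ m := fun m z hz => by
    rw [norm_mul, norm_mul, norm_pow, norm_neg, norm_one, one_pow, one_mul, norm_pow]
    have h1 : ‖tr (lmul (op A ^ m) A)‖ ≤ ‖A‖ ^ (m + 1) :=
      (norm_tr_le _).trans (norm_op_pow_mul_le A m)
    have h2 : ‖z‖ ≤ r := by simpa using (Metric.mem_ball.1 hz).le
    calc ‖tr (lmul (op A ^ m) A)‖ * ‖z‖ ^ m ≤ ‖A‖ ^ (m + 1) * r ^ m := by gcongr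
      _ = ‖A‖ * (r * ‖A‖) ^ m := by ring
  have h0 : Summable fun m : ℕ => logTerm A m 0 := by
    simp [logTerm, summable_zero]
  have hpre : IsPreconnected (Metric.ball (0 : ℂ) r) := (convex_ball _ _).isPreconnected
  have hsum : ∀ z ∈ Metric.ball (0 : ℂ) r, Summable fun m : ℕ => logTerm A m z := fun z hz =>
    summable_of_summable_hasDerivAt_of_isPreconnected hu Metric.isOpen_ball hpre
      (fun m y _ => hasDerivAt_logTerm A m y) hbd (Metric.mem_ball_self hr0) h0 hz
  have hL : ∀ z ∈ Metric.ball (0 : ℂ) r, HasDerivAt (fun z => ∑' m, logTerm A m z)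
      (tr (lmul (resolv (z • A)) A)) z := fun z hz => by
    have := hasDerivAt_tsum_of_isPreconnected hu Metric.isOpen_ball hpre
      (fun m y _ => hasDerivAt_logTerm A m y) hbd (Metric.mem_ball_self hr0) h0 hz
    rwa [(hasSum_tr_resolv_smul (hball z hz)).tsum_eq] at this
  have hF : ∀ z ∈ Metric.ball (0 : ℂ) r, HasDerivAt (fun z : ℂ => detOne (z • A))
      (detOne (z • A) * tr (lmul (resolv (z • A)) A)) z := fun z hz => by
    have h1 : IsUnit (1 + op (z • A)) := isUnit_one_add_op (by rw [norm_smul]; exact hball z hz)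
    have h2 : HasDerivAt (fun z : ℂ => z • A) A z := by
      simpa using (hasDerivAt_id z).smul_const A
    exact (hasFDerivAt_detOne h1).comp_hasDerivAt z h2
  have hG : ∀ z ∈ Metric.ball (0 : ℂ) r,
      HasDerivAt (fun z : ℂ => detOne (z • A) * Complex.exp (-∑' m, logTerm A m z)) 0 z :=
    fun z hz => by
      refine ((hF z hz).mul (hL z hz).neg.cexp).congr_deriv ?_
      simp only [Pi.neg_apply]
      ring
  filter_upwards [Metric.ball_mem_nhds (0 : ℂ) hr0] with z hz
  refine ⟨_, (hsum z hz).hasSum, ?_⟩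
  have hconst := Metric.isOpen_ball.is_const_of_deriv_eq_zero hpre
    (fun y hy => (hG y hy).differentiableAt.differentiableWithinAt)
    (fun y hy => (hG y hy).deriv) hz (Metric.mem_ball_self hr0)
  simp only [zero_smul, detOne_zero, one_mul] at hconst
  have hz0 : ∑' m, logTerm A m 0 = 0 := by simp [logTerm]
  rw [hz0, neg_zero, Complex.exp_zero, Complex.exp_neg, mul_inv_eq_one₀ (Complex.exp_ne_zero _)]
    at hconst
  exact hconst

/-! ### Shifted matrices -/

theorem op_shiftDown (A : TrMat) : op (L1.shiftDown Seq A) = op A * L1.shiftUp ℂ :=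
  seq_clm_ext fun i => by
    rw [op_basisVec, L1.shiftDown_apply, mul_apply_eq_comp, basisVec, L1.shiftUp_single,
      ← basisVec, op_basisVec]

theorem op_shiftUp (A : TrMat) : op (L1.shiftUp Seq A) = op A * L1.shiftDown ℂ :=
  seq_clm_ext fun i => by
    rw [op_basisVec, mul_apply_eq_comp, basisVec]
    rcases i with _ | i
    · rw [L1.shiftUp_apply_zero, L1.shiftDown_single_zero, map_zero]
    · rw [L1.shiftUp_apply_succ, L1.shiftDown_single_succ, ← basisVec, op_basisVec]

theorem op_single_zero (a : Seq) : op (L1.single 0 a) = (coord 0).smulRight a := by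
  ext1 x
  rw [op_single]
  rfl

/-- Since `shiftUp` on columns is right multiplication by the left shift `D`, this is cyclicity,
`tr(T H D) = tr(D T H)`. -/
theorem tr_lmul_shiftUp (T : Seq →L[ℂ] Seq) (H : TrMat) :
    tr (lmul T (L1.shiftUp Seq H)) = tr (lmul (L1.shiftDown ℂ * T) H) := by
  rw [tr_apply, tr_apply, (summable_diag (lmul T (L1.shiftUp Seq H))).tsum_eq_zero_add]
  simp

theorem tr_lmul_single (T : Seq →L[ℂ] Seq) (j : ℕ) (a : Seq) :
    tr (lmul T (L1.single j a)) = T a j := by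
  rw [lmul_single, tr_single]

theorem tr_lmul_smulRight (f : Seq →L[ℂ] ℂ) (x : Seq) (H : TrMat) :
    tr (lmul (f.smulRight x) H) = f (op H x) := by
  have h := ((L1.hasSum_single x).mapL (f.comp (op H))).tsum_eq
  rw [ContinuousLinearMap.comp_apply] at h
  rw [tr_apply, ← h]
  refine tsum_congr fun j => ?_
  rw [lmul_apply, ContinuousLinearMap.smulRight_apply, L1.smul_apply, smul_eq_mul,
    ContinuousLinearMap.comp_apply, single_eq_smul_basisVec, map_smul, op_basisVec, map_smul,
    smul_eq_mul, mul_comm]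

theorem resolv_apply_column {A : TrMat} (hA : IsUnit (1 + op A)) (j : ℕ) :
    resolv A (A j) = basisVec j - resolv A (basisVec j) := by
  have h := congrArg (fun T : Seq →L[ℂ] Seq => T (basisVec j)) (resolv_mul_one_add_op hA)
  simp only [mul_apply_eq_comp, add_apply, one_apply_eq_self, op_basisVec,
    map_add] at h
  rw [eq_sub_iff_add_eq', h]

/-- The determinant of the matrix that is left when the first row and the first column are
removed. -/
theorem detOne_minor {A : TrMat} (hA : IsUnit (1 + op A)) :
    detOne (lmul (L1.shiftDown ℂ) (L1.shiftDown Seq A))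
      = detOne A * resolv A (basisVec 0) 0 := by
  -- `P` kills coordinate `0`. `A'` is `A` with column `0` erased, and `G` has row `0` erased as
  -- well, so that `G` is the minor bordered by zeros.
  set P : Seq →L[ℂ] Seq := L1.shiftUp ℂ * L1.shiftDown ℂ with hP
  set A' : TrMat := A + L1.single 0 (-A 0) with hA'
  set G : TrMat := lmul P A' with hG
  have hA'0 : A' 0 = 0 := by simp [hA']
  have hP0 : ∀ x : Seq, P x 0 = 0 := fun x => by simp [hP]
  have hPs : ∀ (x : Seq) (i : ℕ), P x (i + 1) = x (i + 1) := fun x i => by simp [hP]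
  have h1 : G = L1.shiftUp Seq (lmul (L1.shiftUp ℂ)
      (lmul (L1.shiftDown ℂ) (L1.shiftDown Seq A))) := by
    refine trMat_ext fun j i => ?_
    rw [hG, lmul_apply]
    rcases j with _ | j
    · rw [hA'0, map_zero, L1.shiftUp_apply_zero]
    · have : A' (j + 1) = A (j + 1) := by simp [hA', L1.single_apply]
      rw [this]
      rcases i with _ | i <;> simp [hP0, hPs]
  -- `1 + A' = (1+G)(1+(1-P)A')`, because `G` annihilates the first basis vector. The second factor
  -- has determinant `1`: its perturbation has rank at most one and zero trace.
  have h2 : detOne A' = detOne G := by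
    have h3 : lmul (1 + op G) (lmul (1 - P) A') = lmul (1 - P) A' := by
      refine L1.ext fun j => ?_
      have hy : (1 - P) (A' j) = A' j 0 • basisVec 0 := L1.ext fun i => by
        rcases i with _ | i <;> simp [hP0, hPs, basisVec_apply]
      rw [lmul_apply, lmul_apply, hy, map_smul, add_apply, one_apply_eq_self, op_basisVec, hG,
        lmul_apply, hA'0, map_zero, add_zero]
    have h4 : detOne (lmul (1 - P) A') = 1 := by
      have hc : ∀ j, lmul (1 - P) A' j = A' j 0 • basisVec 0 := fun j => L1.ext fun i => by
        rcases i with _ | i <;> simp [hP0, hPs, basisVec_apply]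
      rw [detOne_of_rank_one _ _ hc, tr_apply, tsum_congr (g := fun _ => (0 : ℂ)) fun j => ?_]
      · simp
      · rw [hc]
        rcases j with _ | j
        · simp [hA'0]
        · simp [basisVec_apply]
    have h5 := detOne_mul G (lmul (1 - P) A')
    rw [h3, h4, mul_one] at h5
    rw [← h5]
    congr 1
    refine L1.ext fun j => ?_
    simp [hG]
  -- Erasing column `0` multiplies the determinant by `1 - (R A₀)₀`, where `A₀` is that column; this
  -- is `R₀₀` since `R A = 1 - R`.
  rw [← detOne_shift, ← h1, ← h2, hA', detOne_add hA, lmul_single, detOne_single, map_neg,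
    resolv_apply_column hA]
  simp [basisVec_apply]

/-! ### The bilinear identity -/

/-- The relations between the matrices `A = A_n` of the Toda lattice, their derivatives `A₁`, `Am`,
`A₁m` in `x₁`, in `x₋₁` and in both variables, and the neighbours `Ap = A_{n+1}`,
`An = A_{n-1}`. -/
structure TodaRelations (s : ℂ) (A A₁ Am A₁m Ap An B : TrMat) (a : Seq) (c : ℂ) : Prop where
  eq_one : A₁ = s • (L1.shiftUp Seq A - lmul (L1.shiftDown ℂ) A) + L1.single 0 a
  eq_neg : Am = s⁻¹ • (L1.shiftDown Seq A - lmul (L1.shiftUp ℂ) A) + B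
  row : ∀ j i, B j (i + 1) = 0
  eq_mixed : A₁m = s • (L1.shiftUp Seq Am - lmul (L1.shiftDown ℂ) Am)
    + L1.single 0 (-s⁻¹ • L1.shiftUp ℂ a + c • basisVec 0 + A 0)
  next : Ap = lmul (L1.shiftDown ℂ) (L1.shiftDown Seq A)
  prev_zero : An 0 = s⁻¹ • L1.shiftUp ℂ a - c • basisVec 0
  prev_succ : ∀ j, An (j + 1) = L1.shiftUp ℂ (A j) - s • B j

namespace TodaRelations

variable {s : ℂ} {A A₁ Am A₁m Ap An B : TrMat} {a : Seq} {c : ℂ}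

theorem smul (h : TodaRelations s A A₁ Am A₁m Ap An B a c) (z : ℂ) :
    TodaRelations s (z • A) (z • A₁) (z • Am) (z • A₁m) (z • Ap) (z • An) (z • B) (z • a)
      (z * c) := by
  have hs : ∀ x : Seq, L1.single 0 (z • x) = z • L1.single 0 x := fun x =>
    map_smul (L1.singleL Seq 0) z x
  refine ⟨?_, ?_, fun j i => by simp [h.row], ?_, ?_, ?_, fun j => ?_⟩
  · rw [h.eq_one, hs, map_smul, map_smul]
    module
  · rw [h.eq_neg, map_smul, map_smul]
    module
  · rw [h.eq_mixed, map_smul, map_smul, map_smul, L1.smul_apply]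
    have : -s⁻¹ • z • L1.shiftUp ℂ a + (z * c) • basisVec 0 + z • A 0
      = z • (-s⁻¹ • L1.shiftUp ℂ a + c • basisVec 0 + A 0) := by module
    rw [this, hs]
    module
  · rw [h.next, map_smul, map_smul]
  · rw [L1.smul_apply, h.prev_zero, map_smul]
    module
  · rw [L1.smul_apply, h.prev_succ, L1.smul_apply, map_smul, L1.smul_apply]
    module

theorem op_row (h : TodaRelations s A A₁ Am A₁m Ap An B a c) (x : Seq) :
    op B x = op B x 0 • basisVec 0 := L1.ext fun i => by
  rcases i with _ | i
  · simp [basisVec_apply]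
  · rw [op_apply_apply]
    simp [h.row, basisVec_apply]

/-- The identities `R A = A R = 1 - R` turn `R [A, D] R` into `[D, R]`. By cyclicity, its trace
against `Am` cancels the commutator part of `tr(R A₁m)`. Only the boundary column of `A₁m` and the
rank-one part of `R A₁ R` remain. -/
theorem trace_identity (h : TodaRelations s A A₁ Am A₁m Ap An B a c)
    (hA : IsUnit (1 + op A)) :
    tr (lmul (resolv A) A₁m) - tr (lmul (resolv A * op A₁ * resolv A) Am)
      = 1 - resolv A (basisVec 0) 0 * (1 - c + op B (resolv A a) 0) := by
  set R := resolv A with hR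
  set S := L1.shiftUp ℂ with hS
  set D := L1.shiftDown ℂ with hD
  have hRA : R * op A = 1 - R := by
    have := resolv_mul_one_add_op hA
    rw [mul_add, mul_one] at this
    rw [← this]; abel
  have hAR : op A * R = 1 - R := by
    have := one_add_op_mul_resolv hA
    rw [add_mul, one_mul] at this
    rw [← this]; abel
  have h1 : R * op A₁ * R = s • (D * R - R * D) + ((coord 0).comp R).smulRight (R a) := by
    have hr : R * (coord 0).smulRight a * R = ((coord 0).comp R).smulRight (R a) := by
      ext1 x; simp
    have : R * op A₁ * R = s • ((R * op A) * D * R - R * D * (op A * R))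
        + R * (coord 0).smulRight a * R := by
      rw [h.eq_one, map_add, map_smul, map_sub, op_shiftUp, op_lmul, op_single_zero]
      simp only [mul_add, add_mul, mul_sub, sub_mul, mul_smul_comm, smul_mul_assoc, mul_assoc, hD]
    rw [this, hRA, hAR, hr]
    congr 2
    noncomm_ring
  have h2 : R * op Am * R = s⁻¹ • (S * R - R * S) + R * op B * R := by
    have : R * op Am * R = s⁻¹ • ((R * op A) * S * R - R * S * (op A * R)) + R * op B * R := by
      rw [h.eq_neg, map_add, map_smul, map_sub, op_shiftDown, op_lmul]
      simp only [mul_add, add_mul, mul_sub, sub_mul, mul_smul_comm, smul_mul_assoc, mul_assoc, hS]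
    rw [this, hRA, hAR]
    congr 2
    noncomm_ring
  have h3 : R (op Am (R a)) 0
      = -(s⁻¹ * R (S a) 0) + op B (R a) 0 * R (basisVec 0) 0 := by
    have h4 := congrArg (fun T : Seq →L[ℂ] Seq => T a 0) h2
    simp only [mul_apply_eq_comp, add_apply, smul_apply, sub_apply, L1.add_apply, L1.smul_apply,
      L1.sub_apply, smul_eq_mul] at h4
    rw [h4, h.op_row (R a), map_smul, L1.smul_apply, hS, L1.shiftUp_apply_zero]
    simp [basisVec_apply]
  have h5 : R (A 0) 0 = 1 - R (basisVec 0) 0 := by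
    rw [hR, resolv_apply_column hA]
    simp [basisVec_apply]
  rw [h1, h.eq_mixed]
  simp only [map_add, map_smul, map_sub, add_apply, smul_apply, sub_apply, tr_lmul_shiftUp,
    ← lmul_mul, tr_lmul_single, tr_lmul_smulRight, ContinuousLinearMap.comp_apply, L1.eval_apply,
    L1.add_apply, L1.smul_apply, smul_eq_mul, h3, h5]
  ring

theorem detOne_next (h : TodaRelations s A A₁ Am A₁m Ap An B a c) (hA : IsUnit (1 + op A)) :
    detOne Ap = detOne A * resolv A (basisVec 0) 0 := by
  rw [h.next, detOne_minor hA]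

/-- `A` is the minor of `An` without the first row and column, so Cramer's rule reduces the claim to
entry `(0,0)` of the inverse of `1 + An`. -/
theorem detOne_prev (h : TodaRelations s A A₁ Am A₁m Ap An B a c) (hs : s ≠ 0)
    (hA : IsUnit (1 + op A)) (hAn : IsUnit (1 + op An)) :
    detOne An = detOne A * (1 - c + op B (resolv A a) 0) := by
  have h1 : A = lmul (L1.shiftDown ℂ) (L1.shiftDown Seq An) := trMat_ext fun j i => by
    simp [h.prev_succ, h.row]
  have h2 : detOne A = detOne An * resolv An (basisVec 0) 0 := by
    rw [h1]; exact detOne_minor hAn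
  have h3 : op An * L1.shiftUp ℂ = L1.shiftUp ℂ * op A - s • op B := seq_clm_ext fun j => by
    rw [mul_apply_eq_comp, basisVec, L1.shiftUp_single, ← basisVec, ← basisVec, op_basisVec,
      h.prev_succ, sub_apply, mul_apply_eq_comp, smul_apply, op_basisVec, op_basisVec]
  set x := resolv A a with hx
  have hxa : x + op A x = a := by
    have := congrArg (fun T : Seq →L[ℂ] Seq => T a) (one_add_op_mul_resolv hA)
    simpa using this
  have hb := h.op_row x
  set β := op B x 0 with hβ
  -- This vector is chosen so that `(1+An) y` is a multiple of the first basis vector: the shifted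
  -- parts cancel since `x + A x = a`. Its own coordinate `0` is `1`.
  set y := basisVec 0 - s⁻¹ • L1.shiftUp ℂ x with hy
  have h4 : (1 + op An) y = (1 - c + β) • basisVec 0 := by
    have h5 : op An (L1.shiftUp ℂ x) = L1.shiftUp ℂ (op A x) - s • op B x :=
      congrArg (fun T : Seq →L[ℂ] Seq => T x) h3
    have h6 : L1.shiftUp ℂ a = L1.shiftUp ℂ x + L1.shiftUp ℂ (op A x) := by
      rw [← map_add, hxa]
    rw [add_apply, one_apply_eq_self, hy, map_sub, map_smul, op_basisVec, h.prev_zero, h5, h6,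
      hb, smul_sub, smul_smul s⁻¹ s, inv_mul_cancel₀ hs]
    module
  have h7 : y = (1 - c + β) • resolv An (basisVec 0) := by
    rw [← map_smul, ← h4, ← mul_apply_eq_comp, resolv_mul_one_add_op hAn, one_apply_eq_self]
  have h8 : 1 = (1 - c + β) * resolv An (basisVec 0) 0 := by
    have := congrArg (fun v : Seq => v 0) h7
    simpa [hy, basisVec_apply] using this
  rw [h2]
  linear_combination detOne An * h8

/-- The bilinear identity for matrices that are small enough. -/
theorem bilinear_of_isUnit (h : TodaRelations s A A₁ Am A₁m Ap An B a c) (hs : s ≠ 0)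
    (hA : IsUnit (1 + op A)) (hAn : IsUnit (1 + op An)) :
    detOne A * (fderiv ℂ (fderiv ℂ detOne) A A₁ Am + fderiv ℂ detOne A A₁m)
      - fderiv ℂ detOne A A₁ * fderiv ℂ detOne A Am
      = detOne A ^ 2 - detOne Ap * detOne An := by
  rw [fderiv_fderiv_detOne_apply hA, fderiv_detOne_apply hA, fderiv_detOne_apply hA,
    fderiv_detOne_apply hA, h.detOne_next hA, h.detOne_prev hs hA hAn]
  linear_combination detOne A ^ 2 * h.trace_identity hA

theorem bilinear (h : TodaRelations s A A₁ Am A₁m Ap An B a c) (hs : s ≠ 0) :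
    detOne A * (fderiv ℂ (fderiv ℂ detOne) A A₁ Am + fderiv ℂ detOne A A₁m)
      - fderiv ℂ detOne A A₁ * fderiv ℂ detOne A Am
      = detOne A ^ 2 - detOne Ap * detOne An := by
  have hd0 : Differentiable ℂ detOne := (contDiff_detOne (n := 1)).differentiable one_ne_zero
  have hd1 : Differentiable ℂ (fderiv ℂ detOne) :=
    ((contDiff_detOne (n := 2)).fderiv_right (m := 1) (by norm_num)).differentiable one_ne_zero
  have hd2 : Differentiable ℂ (fderiv ℂ (fderiv ℂ detOne)) :=
    (((contDiff_detOne (n := 3)).fderiv_right (m := 2) (by norm_num)).fderiv_right (m := 1)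
      (by norm_num)).differentiable one_ne_zero
  have hsm : ∀ X : TrMat, Differentiable ℂ fun z : ℂ => z • X := fun X =>
    differentiable_id.smul_const X
  have hF : ∀ X : TrMat, Differentiable ℂ fun z : ℂ => detOne (z • X) := fun X =>
    hd0.comp (hsm X)
  have hF1 : ∀ X Y : TrMat, Differentiable ℂ fun z : ℂ => fderiv ℂ detOne (z • X) (z • Y) :=
    fun X Y => (hd1.comp (hsm X)).clm_apply (hsm Y)
  have hF2 : Differentiable ℂ fun z : ℂ =>
      fderiv ℂ (fderiv ℂ detOne) (z • A) (z • A₁) (z • Am) :=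
    ((hd2.comp (hsm A)).clm_apply (hsm A₁)).clm_apply (hsm Am)
  have hLd : Differentiable ℂ fun z : ℂ => detOne (z • A)
      * (fderiv ℂ (fderiv ℂ detOne) (z • A) (z • A₁) (z • Am) + fderiv ℂ detOne (z • A) (z • A₁m))
      - fderiv ℂ detOne (z • A) (z • A₁) * fderiv ℂ detOne (z • A) (z • Am) :=
    ((hF A).mul (hF2.add (hF1 A A₁m))).sub ((hF1 A A₁).mul (hF1 A Am))
  have hRd : Differentiable ℂ fun z : ℂ =>
      detOne (z • A) ^ 2 - detOne (z • Ap) * detOne (z • An) :=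
    ((hF A).pow 2).sub ((hF Ap).mul (hF An))
  have hsmall : ∀ X : TrMat, ∀ᶠ z in 𝓝 (0 : ℂ), IsUnit (1 + op (z • X)) := fun X => by
    have h1 : Tendsto (fun z : ℂ => ‖z • X‖) (𝓝 0) (𝓝 0) := by
      have := ((hsm X).continuous.norm).tendsto 0
      simpa only [zero_smul, norm_zero] using this
    filter_upwards [h1.eventually (gt_mem_nhds one_pos)] with z hz
    exact isUnit_one_add_op hz
  have heq := (hLd.differentiableOn.analyticOnNhd isOpen_univ).eq_of_eventuallyEq
    (hRd.differentiableOn.analyticOnNhd isOpen_univ) (z₀ := 0) (by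
      filter_upwards [hsmall A, hsmall An] with z hz hz'
      exact (h.smul z).bilinear_of_isUnit hs hz hz')
  have := congrFun heq 1
  simpa only [one_smul] using this

end TodaRelations

/-! ### Matrices of moments -/

/-- The matrix unit with entry `1` in column `p.1` and row `p.2`. -/
def matUnit (p : ℕ × ℕ) : TrMat := L1.single p.1 (basisVec p.2)

theorem norm_matUnit (p : ℕ × ℕ) : ‖matUnit p‖ = 1 := by
  rw [matUnit, L1.norm_single, norm_basisVec]

theorem matUnit_apply (p : ℕ × ℕ) (j i : ℕ) : matUnit p j i = if (j, i) = p then 1 else 0 := by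
  rw [matUnit, L1.single_apply]
  by_cases hj : j = p.1
  · simp [hj, basisVec_apply, Prod.ext_iff]
  · simp [hj, Prod.ext_iff]

/-- The matrix with given entries, indexed by column and row. -/
def ofEntries (c : ℕ × ℕ → ℂ) : TrMat := ∑' p, c p • matUnit p

theorem norm_smul_matUnit (c : ℂ) (p : ℕ × ℕ) : ‖c • matUnit p‖ = ‖c‖ := by
  rw [norm_smul, norm_matUnit, mul_one]

theorem ofEntries_apply {c : ℕ × ℕ → ℂ} (hc : Summable fun p => ‖c p‖) (j i : ℕ) :
    ofEntries c j i = c (j, i) := by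
  have hs : Summable fun p => c p • matUnit p := Summable.of_norm (by simpa [norm_smul_matUnit])
  have h := (hs.hasSum.mapL ((coord i).comp (L1.eval Seq j))).tsum_eq
  change _ = ofEntries c j i at h
  rw [← h, tsum_eq_single (j, i)]
  · simp [matUnit_apply]
  · intro p hp
    simp [matUnit_apply, hp.symm]

/-- The entries of the matrix of moments. -/
def momentEntry (s : ℂ) (M : ℤ → ℤ → ℂ) (p q : ℤ) (x : ℕ × ℕ) : ℂ :=
  (-1) ^ x.2 * (s ^ x.1 * (s ^ x.2)⁻¹) * M (p + x.2) (q - x.1 - 1)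

/-- The matrix of the moments `M`. -/
def momentMat (s : ℂ) (M : ℤ → ℤ → ℂ) (p q : ℤ) : TrMat := ofEntries (momentEntry s M p q)

/-- Multiplication by `k` moves up one row and contributes `-s D A`; multiplication by `k'` shifts
the columns and leaves `a`, the new column `0`. For the inverses the defect is confined to row `0`.
The boundary column in the mixed relation is the `x₋₁`-derivative of `a`. -/
theorem todaRelations_momentMat {s : ℂ} (hs : s ≠ 0) {M : ℤ → ℤ → ℂ}
    (hM : ∀ p q, Summable fun x => ‖momentEntry s M p q x‖) (n : ℤ) :
    TodaRelations s (momentMat s M n (-n))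
      (momentMat s M (n + 1) (-n) + momentMat s M n (-n + 1))
      (momentMat s M (n - 1) (-n) + momentMat s M n (-n - 1))
      (momentMat s M n (-n) + momentMat s M (n - 1) (-n + 1)
        + (momentMat s M (n + 1) (-n - 1) + momentMat s M n (-n)))
      (-momentMat s M (n + 1) (-n - 1)) (-momentMat s M (n - 1) (-n + 1))
      (momentMat s M (n - 1) (-n) + momentMat s M n (-n - 1)
        - s⁻¹ • (L1.shiftDown Seq (momentMat s M n (-n))
          - lmul (L1.shiftUp ℂ) (momentMat s M n (-n))))
      (momentMat s M n (-n + 1) 0) (M (n - 1) (-n)) := by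
  have happ : ∀ p q j i, momentMat s M p q j i
      = (-1) ^ i * (s ^ j * (s ^ i)⁻¹) * M (p + i) (q - j - 1) := fun p q j i =>
    ofEntries_apply (hM p q) j i
  have e1 : ∀ (p : ℤ) (i : ℕ), p + 1 + i = p + ((i : ℤ) + 1) := fun p i => by ring
  have e2 : ∀ (p : ℤ) (i : ℕ), p - 1 + ((i : ℤ) + 1) = p + i := fun p i => by ring
  have e4 : ∀ (q : ℤ) (j : ℕ), q - 1 - (j : ℤ) - 1 = q - (j + 1) - 1 := fun q j => by ring
  refine ⟨?_, ?_, fun j i => ?_, ?_, ?_, ?_, fun j => ?_⟩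
  · refine trMat_ext fun j i => ?_
    rcases j with _ | j <;>
    simp [happ, L1.single_apply, e1, pow_succ] <;> field_simp <;> ring_nf
  · abel
  · simp [happ, e2, e4, pow_succ]
    field_simp
    ring
  · refine trMat_ext fun j i => ?_
    rcases j with _ | j <;> rcases i with _ | i <;>
    simp [happ, L1.single_apply, e2, e4, pow_succ, basisVec_apply] <;> field_simp <;> ring_nf
  · refine trMat_ext fun j i => ?_
    simp [happ, e1, e4, pow_succ]
    field_simp
    simp
  · refine L1.ext fun i => ?_
    rcases i with _ | i <;> simp [happ, e2, pow_succ, basisVec_apply]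
    field_simp
  · refine L1.ext fun i => ?_
    rcases i with _ | i <;> simp [happ, e2, e4, pow_succ]
    · field_simp
      ring
    · field_simp
      ring

/-! ### Moments of plane waves -/

/-- The plane wave `exp (k x₁ + k⁻¹ x₋₁) exp (k' x₁ + k'⁻¹ x₋₁)`. -/
def planeWave (x : ℝ × ℝ) (z : ℂ × ℂ) : ℂ :=
  Complex.exp (z.1 * x.1 + z.1⁻¹ * x.2) * Complex.exp (z.2 * x.1 + z.2⁻¹ * x.2)

/-- The weight `(s - |k|) (|k'| - s)`. -/
def weight (s : ℝ) (z : ℂ × ℂ) : ℝ := (s - ‖z.1‖) * (‖z.2‖ - s)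

/-- The density of the moments. -/
def momentKernel (w : ℂ × ℂ → ℂ) (p q : ℤ) (x : ℝ × ℝ) (z : ℂ × ℂ) : ℂ :=
  planeWave x z * z.1 ^ p * z.2 ^ q * w z

/-- The moments of the complex measure `w μ` on `D`. -/
def moment (μ : Measure (ℂ × ℂ)) (w : ℂ × ℂ → ℂ) (D : Set (ℂ × ℂ)) (x : ℝ × ℝ) (p q : ℤ) : ℂ :=
  ∫ z in D, momentKernel w p q x z ∂μ

/-- `G` is an upper bound for plane waves with the integrability that is needed for all moments. -/
structure Dominates (μ : Measure (ℂ × ℂ)) (w : ℂ × ℂ → ℂ) (D : Set (ℂ × ℂ)) (s : ℝ)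
    (G : ℂ × ℂ → ℝ) : Prop where
  nonneg : ∀ z, 0 ≤ G z
  integrable : ∀ p q : ℤ,
    IntegrableOn (fun z => G z * ‖z.1‖ ^ p * ‖z.2‖ ^ q * ‖w z‖ / weight s z) D μ

theorem planeWave_ne_zero (x : ℝ × ℝ) (z : ℂ × ℂ) : planeWave x z ≠ 0 :=
  mul_ne_zero (Complex.exp_ne_zero _) (Complex.exp_ne_zero _)

theorem norm_planeWave (x : ℝ × ℝ) (z : ℂ × ℂ) : ‖planeWave x z‖
    = Real.exp ((z.1 + z.2).re * x.1) * Real.exp ((z.1⁻¹ + z.2⁻¹).re * x.2) := by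
  rw [planeWave, norm_mul, Complex.norm_exp, Complex.norm_exp, ← Real.exp_add, ← Real.exp_add]
  congr 1
  simp only [Complex.add_re, Complex.re_mul_ofReal]
  ring

theorem exp_mul_le (α t₀ δ t : ℝ) (ht : |t - t₀| ≤ δ) :
    Real.exp (α * t) ≤ Real.exp (α * (t₀ + δ)) + Real.exp (α * (t₀ - δ)) := by
  obtain ⟨h1, h2⟩ := abs_le.1 ht
  rcases le_total 0 α with h | h
  · refine (Real.exp_le_exp.2 (mul_le_mul_of_nonneg_left ?_ h)).trans
      (le_add_of_nonneg_right (Real.exp_pos _).le)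
    linarith
  · refine (Real.exp_le_exp.2 (mul_le_mul_of_nonpos_left ?_ h)).trans
      (le_add_of_nonneg_left (Real.exp_pos _).le)
    linarith

theorem measurable_planeWave (x : ℝ × ℝ) : Measurable (planeWave x) := by
  unfold planeWave
  fun_prop

theorem measurable_weight (s : ℝ) : Measurable (weight s) := by
  unfold weight
  fun_prop

theorem hasDerivAt_planeWave_fst (b t : ℝ) (z : ℂ × ℂ) :
    HasDerivAt (fun a : ℝ => planeWave (a, b) z) (planeWave (t, b) z * (z.1 ^ (1 : ℤ) + z.2 ^ (1 : ℤ)))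
      t := by
  have h : ∀ k : ℂ, HasDerivAt (fun a : ℝ => Complex.exp (k * (a : ℂ) + k⁻¹ * (b : ℂ)))
      (Complex.exp (k * (t : ℂ) + k⁻¹ * (b : ℂ)) * (k * 1)) t := fun k =>
    (((Complex.ofRealCLM.hasDerivAt (x := t)).const_mul k).add_const _).cexp
  refine ((h z.1).mul (h z.2)).congr_deriv ?_
  simp only [planeWave, zpow_one]
  ring

theorem hasDerivAt_planeWave_snd (a t : ℝ) (z : ℂ × ℂ) :
    HasDerivAt (fun b : ℝ => planeWave (a, b) z)
      (planeWave (a, t) z * (z.1 ^ (-1 : ℤ) + z.2 ^ (-1 : ℤ))) t := by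
  have h : ∀ k : ℂ, HasDerivAt (fun b : ℝ => Complex.exp (k * (a : ℂ) + k⁻¹ * (b : ℂ)))
      (Complex.exp (k * (a : ℂ) + k⁻¹ * (t : ℂ)) * (k⁻¹ * 1)) t := fun k =>
    (((Complex.ofRealCLM.hasDerivAt (x := t)).const_mul k⁻¹).const_add _).cexp
  refine ((h z.1).mul (h z.2)).congr_deriv ?_
  simp only [planeWave, zpow_neg_one]
  ring

/-! ### Integrability of the moments and summability of their matrix -/

section Bounds

variable {μ : Measure (ℂ × ℂ)} {w : ℂ × ℂ → ℂ} {D : Set (ℂ × ℂ)} {s : ℝ}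

theorem weight_pos (hs : ∀ p ∈ D, 0 < ‖p.1‖ ∧ ‖p.1‖ < s ∧ s < ‖p.2‖) {z : ℂ × ℂ} (hz : z ∈ D) :
    0 < weight s z :=
  mul_pos (sub_pos.2 (hs z hz).2.1) (sub_pos.2 (hs z hz).2.2)

theorem weight_le (hs : ∀ p ∈ D, 0 < ‖p.1‖ ∧ ‖p.1‖ < s ∧ s < ‖p.2‖) {z : ℂ × ℂ} (hz : z ∈ D) :
    weight s z ≤ s * ‖z.2‖ := by
  obtain ⟨h1, h2, h3⟩ := hs z hz
  exact mul_le_mul (by linarith) (by linarith) (by linarith) (by linarith)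

theorem Dominates.integrableOn {G : ℂ × ℂ → ℝ} (hG : Dominates μ w D s G) (hD : MeasurableSet D)
    (hs : ∀ p ∈ D, 0 < ‖p.1‖ ∧ ‖p.1‖ < s ∧ s < ‖p.2‖) (p q : ℤ) :
    IntegrableOn (fun z => G z * ‖z.1‖ ^ p * ‖z.2‖ ^ q * ‖w z‖) D μ := by
  -- On `D` the weight is at most `s |k'|`, so removing it costs one power of `k'`.
  refine Integrable.mono' ((hG.integrable p (q + 1)).const_mul s) ?_ ?_
  · refine ((hG.integrable p q).aestronglyMeasurable.mul
      (measurable_weight s).aestronglyMeasurable).congr ?_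
    filter_upwards [ae_restrict_mem hD] with z hz
    simp only [Pi.mul_apply]
    rw [div_mul_cancel₀ _ (weight_pos hs hz).ne']
  · filter_upwards [ae_restrict_mem hD] with z hz
    have hz2 : 0 < ‖z.2‖ := by obtain ⟨h1, h2, h3⟩ := hs z hz; linarith
    have h0 : 0 ≤ G z * ‖z.1‖ ^ p * ‖z.2‖ ^ q * ‖w z‖ := by
      have := hG.nonneg z
      positivity
    rw [Real.norm_of_nonneg h0, zpow_add_one₀ hz2.ne', ← mul_div_assoc,
      le_div_iff₀ (weight_pos hs hz)]
    calc _ ≤ (G z * ‖z.1‖ ^ p * ‖z.2‖ ^ q * ‖w z‖) * (s * ‖z.2‖) :=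
          mul_le_mul_of_nonneg_left (weight_le hs hz) h0
      _ = _ := by ring

theorem norm_momentKernel_le {G : ℂ × ℂ → ℝ} {x : ℝ × ℝ} {z : ℂ × ℂ} (hx : ‖planeWave x z‖ ≤ G z)
    (p q : ℤ) : ‖momentKernel w p q x z‖ ≤ G z * ‖z.1‖ ^ p * ‖z.2‖ ^ q * ‖w z‖ := by
  rw [momentKernel, norm_mul, norm_mul, norm_mul, norm_zpow, norm_zpow]
  gcongr

theorem aestronglyMeasurable_momentKernel (hw : AEStronglyMeasurable w (μ.restrict D)) (p q : ℤ)
    (x : ℝ × ℝ) : AEStronglyMeasurable (momentKernel w p q x) (μ.restrict D) := by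
  have h : Measurable fun z : ℂ × ℂ => planeWave x z * z.1 ^ p * z.2 ^ q := by
    have := measurable_planeWave x
    fun_prop
  exact h.aestronglyMeasurable.mul hw

theorem Dominates.integrable_momentKernel {G : ℂ × ℂ → ℝ} (hG : Dominates μ w D s G)
    (hD : MeasurableSet D) (hs : ∀ p ∈ D, 0 < ‖p.1‖ ∧ ‖p.1‖ < s ∧ s < ‖p.2‖)
    (hw : AEStronglyMeasurable w (μ.restrict D)) {x : ℝ × ℝ} (hx : ∀ z, ‖planeWave x z‖ ≤ G z)
    (p q : ℤ) : IntegrableOn (momentKernel w p q x) D μ :=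
  Integrable.mono' (hG.integrableOn hD hs p q) (aestronglyMeasurable_momentKernel hw p q x)
    (Eventually.of_forall fun z => norm_momentKernel_le (hx z) p q)

/-- The ratio of the entries of the matrix of moments to the weighted moments. -/
def entryRatio (s : ℝ) (x : ℕ × ℕ) (z : ℂ × ℂ) : ℝ :=
  weight s z / ‖z.2‖ * ((s / ‖z.2‖) ^ x.1 * (‖z.1‖ / s) ^ x.2)

theorem measurable_entryRatio (s : ℝ) (x : ℕ × ℕ) : Measurable (entryRatio s x) := by
  have := measurable_weight s
  unfold entryRatio
  fun_prop

theorem entryRatio_nonneg (hs : ∀ p ∈ D, 0 < ‖p.1‖ ∧ ‖p.1‖ < s ∧ s < ‖p.2‖) {z : ℂ × ℂ}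
    (hz : z ∈ D) (x : ℕ × ℕ) : 0 ≤ entryRatio s x z := by
  obtain ⟨h1, h2, h3⟩ := hs z hz
  have hs0 : 0 < s := h1.trans h2
  have := weight_pos hs hz
  unfold entryRatio
  positivity

/-- Summing both geometric series yields `|k'|/(|k'|-s) · s/(s-|k|)`, and the prefactor
`weight/|k'|` leaves exactly `s`. -/
theorem sum_entryRatio_le (hs : ∀ p ∈ D, 0 < ‖p.1‖ ∧ ‖p.1‖ < s ∧ s < ‖p.2‖) {z : ℂ × ℂ}
    (hz : z ∈ D) (F : Finset (ℕ × ℕ)) : ∑ x ∈ F, entryRatio s x z ≤ s := by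
  obtain ⟨h1, h2, h3⟩ := hs z hz
  have hs0 : 0 < s := h1.trans h2
  have hz2 : 0 < ‖z.2‖ := hs0.trans h3
  have hr0 : 0 ≤ ‖z.1‖ / s := by positivity
  have hr1 : ‖z.1‖ / s < 1 := (div_lt_one hs0).2 h2
  have ht0 : 0 ≤ s / ‖z.2‖ := by positivity
  have ht1 : s / ‖z.2‖ < 1 := (div_lt_one hz2).2 h3
  have hsum : HasSum (fun x : ℕ × ℕ => (s / ‖z.2‖) ^ x.1 * (‖z.1‖ / s) ^ x.2)
      ((1 - s / ‖z.2‖)⁻¹ * (1 - ‖z.1‖ / s)⁻¹) :=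
    (hasSum_geometric_of_lt_one ht0 ht1).mul (hasSum_geometric_of_lt_one hr0 hr1)
      (Summable.mul_of_nonneg (f := fun j : ℕ => (s / ‖z.2‖) ^ j)
        (g := fun i : ℕ => (‖z.1‖ / s) ^ i) (summable_geometric_of_lt_one ht0 ht1)
        (summable_geometric_of_lt_one hr0 hr1) (fun j => by positivity) fun i => by positivity)
  unfold entryRatio
  rw [← Finset.mul_sum]
  refine (mul_le_mul_of_nonneg_left (sum_le_hasSum F (fun x _ => by positivity) hsum)
    (div_nonneg (weight_pos hs hz).le hz2.le)).trans_eq ?_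
  have e1 : ‖z.2‖ - s ≠ 0 := (sub_pos.2 h3).ne'
  have e2 : s - ‖z.1‖ ≠ 0 := (sub_pos.2 h2).ne'
  rw [weight, one_sub_div hz2.ne', one_sub_div hs0.ne']
  field_simp

/-- The bound `u` does not depend on `x`, as termwise differentiation of the matrix requires. Its
finite sums are integrals bounded by `sum_entryRatio_le`. -/
theorem Dominates.exists_summable {G : ℂ × ℂ → ℝ} (hG : Dominates μ w D s G) (hs0 : 0 < s)
    (hD : MeasurableSet D) (hs : ∀ p ∈ D, 0 < ‖p.1‖ ∧ ‖p.1‖ < s ∧ s < ‖p.2‖) (p q : ℤ) :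
    ∃ u : ℕ × ℕ → ℝ, Summable u ∧ ∀ x : ℝ × ℝ, (∀ z, ‖planeWave x z‖ ≤ G z) → ∀ y,
      ‖momentEntry s (moment μ w D x) p q y‖ ≤ u y := by
  set h : ℂ × ℂ → ℝ := fun z => G z * ‖z.1‖ ^ p * ‖z.2‖ ^ q * ‖w z‖ / weight s z with hh
  have hh0 : ∀ z ∈ D, 0 ≤ h z := fun z hz => by
    have h1 := hG.nonneg z
    have h2 := weight_pos hs hz
    rw [hh]; positivity
  have hint : IntegrableOn h D μ := hG.integrable p q
  have hF : ∀ F : Finset (ℕ × ℕ), ∀ z ∈ D, ∑ y ∈ F, h z * entryRatio s y z ≤ s * h z :=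
    fun F z hz => by
      rw [← Finset.mul_sum, mul_comm s]
      exact mul_le_mul_of_nonneg_left (sum_entryRatio_le hs hz F) (hh0 z hz)
  have hint' : ∀ y, IntegrableOn (fun z => h z * entryRatio s y z) D μ := fun y => by
    refine Integrable.mono' (hint.const_mul s)
      (hint.aestronglyMeasurable.mul (measurable_entryRatio s y).aestronglyMeasurable) ?_
    filter_upwards [ae_restrict_mem hD] with z hz
    rw [Real.norm_of_nonneg (mul_nonneg (hh0 z hz) (entryRatio_nonneg hs hz y))]
    simpa using hF {y} z hz
  refine ⟨fun y => ∫ z in D, h z * entryRatio s y z ∂μ, ?_, fun x hx y => ?_⟩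
  · refine summable_of_sum_le (c := ∫ z in D, s * h z ∂μ) (fun y => ?_) fun F => ?_
    · exact setIntegral_nonneg hD fun z hz => mul_nonneg (hh0 z hz) (entryRatio_nonneg hs hz y)
    · rw [← integral_finsetSum _ fun y _ => hint' y]
      refine setIntegral_mono_on (integrable_finsetSum _ fun y _ => hint' y) (hint.const_mul s) hD
        fun z hz => hF F z hz
  · rw [momentEntry, moment, ← integral_const_mul]
    refine norm_integral_le_of_norm_le (hint' y) ?_
    filter_upwards [ae_restrict_mem hD] with z hz
    obtain ⟨h1, h2, h3⟩ := hs z hz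
    have hz2 : 0 < ‖z.2‖ := hs0.trans h3
    have hW := weight_pos hs hz
    rw [norm_mul, norm_mul, norm_mul, norm_inv, norm_pow, norm_pow, norm_pow, norm_neg, norm_one,
      one_pow, one_mul, Complex.norm_real, Real.norm_of_nonneg hs0.le]
    calc _ ≤ s ^ y.1 * (s ^ y.2)⁻¹
          * (G z * ‖z.1‖ ^ (p + y.2) * ‖z.2‖ ^ (q - y.1 - 1) * ‖w z‖) := by
          gcongr
          exact norm_momentKernel_le (hx z) _ _
      _ = _ := by
          rw [zpow_add₀ h1.ne', zpow_sub₀ hz2.ne', zpow_sub₀ hz2.ne', zpow_natCast, zpow_natCast,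
            zpow_one, hh, entryRatio, div_pow, div_pow]
          field_simp

end Bounds

/-! ### Differentiation of the matrix of moments -/

section Differentiation

variable {μ : Measure (ℂ × ℂ)} {w : ℂ × ℂ → ℂ} {D : Set (ℂ × ℂ)} {s : ℝ} {V : Set (ℝ × ℝ)}

/-- The modulus of a plane wave is a product of real exponentials, linear in `x₁` and in `x₋₁`. On a
closed square in `V` it is at most the sum of its values at the four corners, where the hypothesis
applies. -/
theorem exists_dominates (hV : IsOpen V)
    (hconv : ∀ x ∈ V, ∀ p q : ℤ,
      IntegrableOn (fun z => momentKernel w p q x z / (weight s z : ℂ)) D μ)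
    (hD : MeasurableSet D) (hs : ∀ p ∈ D, 0 < ‖p.1‖ ∧ ‖p.1‖ < s ∧ s < ‖p.2‖)
    {x₀ : ℝ × ℝ} (hx₀ : x₀ ∈ V) : ∃ G : ℂ × ℂ → ℝ, Dominates μ w D s G ∧
      ∀ᶠ x in 𝓝 x₀, x ∈ V ∧ ∀ z, ‖planeWave x z‖ ≤ G z := by
  obtain ⟨δ, hδ, hball⟩ := Metric.nhds_basis_closedBall.mem_iff.1 (hV.mem_nhds hx₀)
  have hmem : ∀ a b : ℝ, |a| ≤ δ → |b| ≤ δ → (x₀.1 + a, x₀.2 + b) ∈ V := fun a b ha hb =>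
    hball (by simp [Prod.dist_eq, ha, hb])
  have hint : ∀ x ∈ V, ∀ p q : ℤ, IntegrableOn
      (fun z => ‖planeWave x z‖ * ‖z.1‖ ^ p * ‖z.2‖ ^ q * ‖w z‖ / weight s z) D μ :=
    fun x hx p q => by
      refine (hconv x hx p q).norm.congr ?_
      filter_upwards [ae_restrict_mem hD] with z hz
      rw [norm_div, Complex.norm_real, Real.norm_of_nonneg (weight_pos hs hz).le, momentKernel,
        norm_mul, norm_mul, norm_mul, norm_zpow, norm_zpow]
  have hd : |δ| ≤ δ := (abs_of_pos hδ).le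
  have hd' : |-δ| ≤ δ := by rw [abs_neg]; exact hd
  refine ⟨fun z => ‖planeWave (x₀.1 + δ, x₀.2 + δ) z‖ + ‖planeWave (x₀.1 + δ, x₀.2 + -δ) z‖
    + ‖planeWave (x₀.1 + -δ, x₀.2 + δ) z‖ + ‖planeWave (x₀.1 + -δ, x₀.2 + -δ) z‖,
    ⟨fun z => by positivity, fun p q => ?_⟩, ?_⟩
  · have := (((hint _ (hmem δ δ hd hd) p q).add (hint _ (hmem δ (-δ) hd hd') p q)).add
      (hint _ (hmem (-δ) δ hd' hd) p q)).add (hint _ (hmem (-δ) (-δ) hd' hd') p q)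
    refine this.congr (Eventually.of_forall fun z => ?_)
    simp only [Pi.add_apply]
    ring
  · filter_upwards [Metric.closedBall_mem_nhds x₀ hδ] with x hx
    refine ⟨hball hx, fun z => ?_⟩
    rw [Metric.mem_closedBall, Prod.dist_eq, max_le_iff, Real.dist_eq, Real.dist_eq] at hx
    simp only [norm_planeWave]
    have e1 := exp_mul_le (z.1 + z.2).re x₀.1 δ x.1 hx.1
    have e2 := exp_mul_le (z.1⁻¹ + z.2⁻¹).re x₀.2 δ x.2 hx.2
    refine (mul_le_mul e1 e2 (Real.exp_pos _).le (by positivity)).trans_eq ?_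
    simp only [← sub_eq_add_neg]
    ring

/-- Here `φ` is a line parallel to a coordinate axis and `e = ±1`. Differentiation only changes
exponents, so the bounds for all exponents also dominate the derivative. -/
theorem hasDerivAt_moment (hV : IsOpen V)
    (hconv : ∀ x ∈ V, ∀ p q : ℤ,
      IntegrableOn (fun z => momentKernel w p q x z / (weight s z : ℂ)) D μ)
    (hD : MeasurableSet D) (hs : ∀ p ∈ D, 0 < ‖p.1‖ ∧ ‖p.1‖ < s ∧ s < ‖p.2‖)
    (hw : AEStronglyMeasurable w (μ.restrict D)) {φ : ℝ → ℝ × ℝ} (hφ : Continuous φ) {e : ℤ}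
    (hφe : ∀ t z, HasDerivAt (fun t => planeWave (φ t) z) (planeWave (φ t) z * (z.1 ^ e + z.2 ^ e)) t)
    (p q : ℤ) {t₀ : ℝ} (ht₀ : φ t₀ ∈ V) :
    HasDerivAt (fun t => moment μ w D (φ t) p q)
      (moment μ w D (φ t₀) (p + e) q + moment μ w D (φ t₀) p (q + e)) t₀ := by
  obtain ⟨G, hG, hev⟩ := exists_dominates hV hconv hD hs ht₀
  have hev' : ∀ᶠ t in 𝓝 t₀, ∀ z, ‖planeWave (φ t) z‖ ≤ G z :=
    (hφ.tendsto t₀).eventually (hev.mono fun x hx => hx.2)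
  have hx₀ : ∀ z, ‖planeWave (φ t₀) z‖ ≤ G z := hev'.self_of_nhds
  have hint := fun p q => hG.integrable_momentKernel hD hs hw hx₀ p q
  have hker : ∀ᵐ z ∂μ.restrict D, ∀ t, planeWave (φ t) z * (z.1 ^ e + z.2 ^ e) * z.1 ^ p * z.2 ^ q
      * w z = momentKernel w (p + e) q (φ t) z + momentKernel w p (q + e) (φ t) z := by
    filter_upwards [ae_restrict_mem hD] with z hz t
    obtain ⟨h1, h2, h3⟩ := hs z hz
    have hz1 : z.1 ≠ 0 := norm_pos_iff.1 h1
    have hz2 : z.2 ≠ 0 := norm_pos_iff.1 (h1.trans (h2.trans h3))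
    rw [momentKernel, momentKernel, zpow_add₀ hz1, zpow_add₀ hz2]
    ring
  have key := (hasDerivAt_integral_of_dominated_loc_of_deriv_le (μ := μ.restrict D)
    (F := fun t z => momentKernel w p q (φ t) z)
    (F' := fun t z => planeWave (φ t) z * (z.1 ^ e + z.2 ^ e) * z.1 ^ p * z.2 ^ q * w z)
    (bound := fun z => G z * ‖z.1‖ ^ (p + e) * ‖z.2‖ ^ q * ‖w z‖
      + G z * ‖z.1‖ ^ p * ‖z.2‖ ^ (q + e) * ‖w z‖) (x₀ := t₀) hev'
    (Eventually.of_forall fun t => aestronglyMeasurable_momentKernel hw p q (φ t))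
    (hint p q) ?_ ?_ ((hG.integrableOn hD hs _ _).add (hG.integrableOn hD hs _ _)) ?_).2
  · rw [integral_congr_ae (hker.mono fun z hz => hz t₀)] at key
    rwa [integral_add (hint _ _) (hint _ _)] at key
  · exact ((hint (p + e) q).add (hint p (q + e))).aestronglyMeasurable.congr
      (hker.mono fun z hz => (hz t₀).symm)
  · filter_upwards [hker] with z hz t ht
    rw [hz t]
    exact (norm_add_le _ _).trans
      (add_le_add (norm_momentKernel_le (ht z) _ _) (norm_momentKernel_le (ht z) _ _))
  · exact Eventually.of_forall fun z t _ => (((hφe t z).mul_const _).mul_const _).mul_const _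

theorem hasDerivAt_momentMat (hV : IsOpen V) (hs0 : 0 < s)
    (hconv : ∀ x ∈ V, ∀ p q : ℤ,
      IntegrableOn (fun z => momentKernel w p q x z / (weight s z : ℂ)) D μ)
    (hD : MeasurableSet D) (hs : ∀ p ∈ D, 0 < ‖p.1‖ ∧ ‖p.1‖ < s ∧ s < ‖p.2‖)
    (hw : AEStronglyMeasurable w (μ.restrict D)) {φ : ℝ → ℝ × ℝ} (hφ : Continuous φ) {e : ℤ}
    (hφe : ∀ t z, HasDerivAt (fun t => planeWave (φ t) z) (planeWave (φ t) z * (z.1 ^ e + z.2 ^ e)) t)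
    (p q : ℤ) {t₀ : ℝ} (ht₀ : φ t₀ ∈ V) :
    HasDerivAt (fun t => momentMat s (moment μ w D (φ t)) p q)
      (momentMat s (moment μ w D (φ t₀)) (p + e) q + momentMat s (moment μ w D (φ t₀)) p (q + e))
      t₀ := by
  obtain ⟨G, hG, hev⟩ := exists_dominates hV hconv hD hs ht₀
  obtain ⟨ε, hε, hball⟩ := Metric.eventually_nhds_iff_ball.1 ((hφ.tendsto t₀).eventually hev)
  obtain ⟨u, hu, hub⟩ := hG.exists_summable hs0 hD hs p q
  obtain ⟨u₁, hu₁, hub₁⟩ := hG.exists_summable hs0 hD hs (p + e) q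
  obtain ⟨u₂, hu₂, hub₂⟩ := hG.exists_summable hs0 hD hs p (q + e)
  have ht₀b := Metric.mem_ball_self (x := t₀) hε
  have hG₀ := (hball t₀ ht₀b).2
  have hsum : ∀ {p q : ℤ} {u : ℕ × ℕ → ℝ}, Summable u → (∀ y,
      ‖momentEntry s (moment μ w D (φ t₀)) p q y‖ ≤ u y) →
      Summable fun y => momentEntry s (moment μ w D (φ t₀)) p q y • matUnit y := fun hu h =>
    Summable.of_norm_bounded hu fun y => by rw [norm_smul_matUnit]; exact h y
  have key := hasDerivAt_tsum_of_isPreconnected (𝕜 := ℝ) (F := TrMat) (hu₁.add hu₂)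
    (Metric.isOpen_ball (x := t₀) (ε := ε)) (convex_ball t₀ ε).isPreconnected
    (g := fun y t => momentEntry s (moment μ w D (φ t)) p q y • matUnit y)
    (g' := fun y t => (momentEntry s (moment μ w D (φ t)) (p + e) q y
      + momentEntry s (moment μ w D (φ t)) p (q + e) y) • matUnit y)
    (fun y t ht => ?_) (fun y t ht => ?_) ht₀b (hsum hu (hub _ hG₀)) ht₀b
  · simp only [add_smul] at key
    rwa [(hsum hu₁ (hub₁ _ hG₀)).tsum_add (hsum hu₂ (hub₂ _ hG₀))] at key
  · refine HasDerivAt.smul_const ?_ (matUnit y)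
    have h := (hasDerivAt_moment hV hconv hD hs hw hφ hφe (p + y.2) (q - y.1 - 1)
      (hball t ht).1).const_mul ((-1) ^ y.2 * ((s : ℂ) ^ y.1 * ((s : ℂ) ^ y.2)⁻¹))
    refine h.congr_deriv ?_
    have e1 : p + (y.2 : ℤ) + e = p + e + y.2 := by ring
    have e2 : q - (y.1 : ℤ) - 1 + e = q + e - y.1 - 1 := by ring
    rw [momentEntry, momentEntry, e1, e2, mul_add]
  · rw [norm_smul_matUnit]
    exact (norm_add_le _ _).trans (add_le_add (hub₁ _ (hball t ht).2 y) (hub₂ _ (hball t ht).2 y))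

end Differentiation

/-! ### Determinants of matrices that are indexed by `ℤ × ℤ` -/

theorem ipow_Lam (m : ℕ) (i j : ℤ) : ipow Lam m i j = if j = i + m then 1 else 0 := by
  induction m generalizing j with
  | zero => simp [ipow, Matrix.one_apply, eq_comm]
  | succ m ih =>
    simp only [ipow, imul, ih]
    rw [tsum_eq_single (i + m)]
    · simp [Lam, add_assoc]
    · intro l hl
      rw [if_neg hl, zero_mul]

theorem ipow_neg_Lam (m : ℕ) (i j : ℤ) :
    ipow (-Lam) m i j = if j = i + m then (-1) ^ m else 0 := by
  induction m generalizing j with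
  | zero => simp [ipow, Matrix.one_apply, eq_comm]
  | succ m ih =>
    simp only [ipow, imul, ih]
    rw [tsum_eq_single (i + m)]
    · simp only [if_true, Matrix.neg_apply, Lam, Nat.cast_add, Nat.cast_one, add_assoc]
      split_ifs <;> ring
    · intro l hl
      rw [if_neg hl, zero_mul]

theorem imul_projO (U : Matrix ℤ ℤ ℂ) (i j : ℤ) :
    imul U projO i j = if j = 0 then U i 0 else 0 := by
  simp only [imul, projO]
  rw [tsum_eq_single 0]
  · simp
  · intro l hl
    simp [hl]

theorem Omega_apply (a b : ℤ) : Omega a b =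
    -∑' m : ℕ, (if 0 = a + (m + 1 : ℕ) then (-1) ^ (m + 1) else 0) * if b = m then 1 else 0 := by
  simp only [Omega, negLamTInvPow]
  congr 1
  refine tsum_congr fun m => ?_
  simp only [imul.eq_1 (imul _ _), imul_projO, ipow_neg_Lam, ipow_Lam]
  rw [tsum_eq_single 0]
  · simp
  · intro l hl
    simp [hl]

theorem Omega_ofNat (i : ℕ) (b : ℤ) : Omega (i : ℤ) b = 0 := by
  rw [Omega_apply, neg_eq_zero]
  refine (tsum_congr fun m => ?_).trans tsum_zero
  rw [if_neg (by omega), zero_mul]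

theorem Omega_negSucc (i : ℕ) (b : ℤ) :
    Omega (Int.negSucc i) b = if b = i then (-1) ^ i else 0 := by
  rw [Omega_apply, tsum_eq_single i]
  · rw [if_pos (by simp [Int.negSucc_eq])]
    split_ifs <;> ring
  · intro m hm
    rw [if_neg, zero_mul]
    rw [Int.negSucc_eq]
    omega

theorem imul_Omega_ofNat (C : Matrix ℤ ℤ ℂ) (i : ℕ) (b : ℤ) : imul Omega C (i : ℤ) b = 0 := by
  simp [imul, Omega_ofNat]

theorem imul_Omega_negSucc (C : Matrix ℤ ℤ ℂ) (i : ℕ) (b : ℤ) :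
    imul Omega C (Int.negSucc i) b = (-1) ^ i * C i b := by
  simp only [imul, Omega_negSucc]
  rw [tsum_eq_single (i : ℤ)]
  · simp
  · intro l hl
    rw [if_neg hl, zero_mul]

theorem hasSum_int_of_negSucc {f : ℤ → ℂ} {a : ℂ} (h0 : ∀ i : ℕ, f i = 0)
    (h : HasSum (fun j : ℕ => f (Int.negSucc j)) a) : HasSum f a := by
  have hinj : Function.Injective Int.negSucc := fun i j hij => Int.negSucc.inj hij
  refine (hinj.hasSum_iff fun l hl => ?_).1 h
  rcases l with i | i
  · exact h0 i
  · exact absurd ⟨i, rfl⟩ hl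

theorem hasSum_op_apply (A : TrMat) (x : Seq) (i : ℕ) :
    HasSum (fun j => x j * A j i) (op A x i) := by
  have h := ((L1.hasSum_single x).mapL (op A)).mapL (coord i)
  refine h.congr_fun fun j => ?_
  rw [single_eq_smul_basisVec, map_smul, op_basisVec, map_smul, L1.eval_apply, smul_eq_mul]

/-! ### Passage from ℤ × ℤ to the rescaled block over ℕ × ℕ -/

section HasDet

variable {s : ℂ} {U : Matrix ℤ ℤ ℂ} {A : TrMat} {v : ℤ → Seq}

theorem hasSum_mul_of_rows (h0 : ∀ (i : ℕ) (b : ℤ), U i b = 0)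
    (h1 : ∀ (i : ℕ) (b : ℤ), U (Int.negSucc i) b = s ^ i * v b i)
    (hv : ∀ j : ℕ, A j = s ^ j • v (Int.negSucc j)) (T : Seq →L[ℂ] Seq) (i : ℕ) (b : ℤ) :
    HasSum (fun l : ℤ => s ^ i * T (v l) i * U l b) (s ^ i * (T * op A) (v b) i) := by
  refine hasSum_int_of_negSucc (fun l => by rw [h0, mul_zero]) ?_
  rw [← op_lmul]
  refine ((hasSum_op_apply (lmul T A) (v b) i).mul_left (s ^ i)).congr_fun fun j => ?_
  rw [lmul_apply, hv, map_smul, L1.smul_apply, h1, smul_eq_mul]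
  ring

theorem ipow_succ_ofNat (h0 : ∀ (i : ℕ) (b : ℤ), U i b = 0) (m i : ℕ) (b : ℤ) :
    ipow U (m + 1) i b = 0 := by
  induction m generalizing b with
  | zero =>
    rw [ipow, imul, tsum_eq_single (i : ℤ)]
    · rw [h0, mul_zero]
    · intro l hl
      rw [ipow, Matrix.one_apply_ne hl.symm, zero_mul]
  | succ m ih =>
    rw [ipow, imul]
    simp [ih]

theorem ipow_succ_negSucc (h0 : ∀ (i : ℕ) (b : ℤ), U i b = 0)
    (h1 : ∀ (i : ℕ) (b : ℤ), U (Int.negSucc i) b = s ^ i * v b i)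
    (hv : ∀ j : ℕ, A j = s ^ j • v (Int.negSucc j)) (m i : ℕ) (b : ℤ) :
    ipow U (m + 1) (Int.negSucc i) b = s ^ i * (op A ^ m) (v b) i := by
  induction m generalizing b with
  | zero =>
    rw [ipow, imul, tsum_eq_single (Int.negSucc i)]
    · rw [ipow, Matrix.one_apply_eq, one_mul, h1, pow_zero, one_apply_eq_self]
    · intro l hl
      rw [ipow, Matrix.one_apply_ne hl.symm, zero_mul]
  | succ m ih =>
    rw [ipow, imul, pow_succ]
    simp only [ih]
    exact (hasSum_mul_of_rows h0 h1 hv _ i b).tsum_eq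

/-- `A` is the block of `U` over negative indices, conjugated by the powers of `s`. The zero rows of
`U` make every sum over ℤ collapse to this block, so positive powers have the same traces. -/
theorem hasDetOneAdd_of_rows (h0 : ∀ (i : ℕ) (b : ℤ), U i b = 0)
    (h1 : ∀ (i : ℕ) (b : ℤ), U (Int.negSucc i) b = s ^ i * v b i)
    (hv : ∀ j : ℕ, A j = s ^ j • v (Int.negSucc j)) : HasDetOneAdd U (detOne A) := by
  have htr : ∀ m : ℕ, HasSum (fun i : ℤ => ipow U (m + 1) i i) (tr (lmul (op A ^ m) A)) :=
    fun m => by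
      refine hasSum_int_of_negSucc (fun i => ipow_succ_ofNat h0 m i _) ?_
      refine (summable_diag (lmul (op A ^ m) A)).hasSum.congr_fun fun j => ?_
      rw [ipow_succ_negSucc h0 h1 hv, lmul_apply, hv, map_smul, L1.smul_apply, smul_eq_mul]
  refine ⟨fun m i j => ?_, fun m => (htr m).summable, fun z => detOne (z • A), ?_, ?_, ?_⟩
  · rcases m with _ | m
    · refine (hasSum_single i fun l hl => ?_).summable
      rw [ipow, Matrix.one_apply_ne hl.symm, zero_mul]
    · rcases i with i | i
      · refine summable_zero.congr fun l => ?_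
        rw [Int.ofNat_eq_natCast, ipow_succ_ofNat h0, zero_mul]
      · simp only [ipow_succ_negSucc h0 h1 hv]
        exact (hasSum_mul_of_rows h0 h1 hv _ i j).summable
  · exact ((contDiff_detOne (n := 1)).differentiable one_ne_zero).comp
      (differentiable_id.smul_const A)
  · filter_upwards [detOne_smul_eq_exp A] with z ⟨L, hL, hz⟩
    refine ⟨L, hL.congr_fun fun m => ?_, hz⟩
    rw [logTerm, logDetCoeff, itrace, (htr m).tsum_eq]
  · simp only [one_smul]

end HasDet

theorem HasDetOneAdd.detOneAdd_eq {U : Matrix ℤ ℤ ℂ} {d : ℂ} (h : HasDetOneAdd U d) :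
    detOneAdd U = d := by
  have hex : ∃ d, HasDetOneAdd U d := ⟨d, h⟩
  rw [detOneAdd, dif_pos hex]
  exact hex.choose_spec.unique h

/-! ### Hirota's bilinear derivative -/

theorem hirotaDD_self {f : ℝ → ℝ → ℂ} {x₁ xm : ℝ} (h1 : DifferentiableAt ℝ (fun a => f a xm) x₁)
    (h2 : DifferentiableAt ℝ (fun a => deriv (fun b => f a b) xm) x₁) :
    hirotaDD f f x₁ xm = 2 * (f x₁ xm * deriv (fun a => deriv (fun b => f a b) xm) x₁
      - deriv (fun a => f a xm) x₁ * deriv (fun b => f x₁ b) xm) := by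
  simp only [hirotaDD, deriv_mul_const_field, deriv_const_mul_field]
  rw [deriv_fun_sub (h2.mul_const _) (h1.mul_const _), deriv_fun_sub (h1.const_mul _) (h2.const_mul _)]
  simp only [deriv_mul_const_field, deriv_const_mul_field]
  ring

/-! ### The tau function -/

theorem integrandC_eq (n i j : ℤ) (x : ℝ × ℝ) {z : ℂ × ℂ} (h1 : z.1 ≠ 0) (h2 : z.2 ≠ 0) :
    integrandC n x.1 x.2 i j z = (-1) ^ n * (planeWave x z * z.1 ^ (n + i) * z.2 ^ (j - n)) := by
  have e : (-z.2) ^ (-n) = (-1) ^ n * z.2 ^ (-n) := by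
    rw [← neg_one_mul, mul_zpow, zpow_neg (-1 : ℂ) n, ← inv_zpow, inv_neg_one]
  rw [integrandC, rho, sigma, cvec, cvec, planeWave, e, zpow_add₀ h1, sub_eq_add_neg, zpow_add₀ h2]
  ring

theorem hasDerivAt_detOne_comp {f : ℝ → TrMat} {f' : TrMat} {t : ℝ} (hf : HasDerivAt f f' t) :
    HasDerivAt (fun t => detOne (f t)) (fderiv ℂ detOne (f t) f') t :=
  (((contDiff_detOne (n := 1)).differentiable one_ne_zero (f t)).hasFDerivAt.restrictScalars
    ℝ).comp_hasDerivAt t hf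

theorem hasDerivAt_fderiv_detOne_comp {f g : ℝ → TrMat} {f' g' : TrMat} {t : ℝ}
    (hf : HasDerivAt f f' t) (hg : HasDerivAt g g' t) :
    HasDerivAt (fun t => fderiv ℂ detOne (f t) (g t))
      (fderiv ℂ (fderiv ℂ detOne) (f t) f' (g t) + fderiv ℂ detOne (f t) g') t := by
  have hd : DifferentiableAt ℂ (fderiv ℂ detOne) (f t) :=
    ((contDiff_detOne (n := 2)).fderiv_right (m := 1) (by norm_num)).differentiable one_ne_zero _
  have h1 : HasFDerivAt (fun p : TrMat × TrMat => fderiv ℂ detOne p.1 p.2) _ (f t, g t) :=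
    (HasFDerivAt.comp (f t, g t) (g := fderiv ℂ detOne) hd.hasFDerivAt hasFDerivAt_fst).clm_apply
      hasFDerivAt_snd
  refine ((h1.restrictScalars ℝ).comp_hasDerivAt t (hf.prodMk hg)).congr_deriv ?_
  simp [add_comm]

section Tau

variable {μ : Measure (ℂ × ℂ)} {w : ℂ × ℂ → ℂ} {D : Set (ℂ × ℂ)} {s : ℝ} {V : Set (ℝ × ℝ)}

theorem Cmat_eq (hD : MeasurableSet D) (hs : ∀ p ∈ D, 0 < ‖p.1‖ ∧ ‖p.1‖ < s ∧ s < ‖p.2‖)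
    (n i j : ℤ) (x : ℝ × ℝ) :
    Cmat μ w D n x.1 x.2 i j = (-1) ^ n * moment μ w D x (n + i) (j - n) := by
  rw [Cmat, moment, ← integral_const_mul]
  refine setIntegral_congr_fun hD fun z hz => ?_
  obtain ⟨h1, h2, h3⟩ := hs z hz
  rw [integrandC_eq n i j x (norm_pos_iff.1 h1) (norm_pos_iff.1 (h1.trans (h2.trans h3))),
    momentKernel]
  ring

/-- The matrix `Ω C_n` in a rescaled basis. -/
def tauMat (μ : Measure (ℂ × ℂ)) (w : ℂ × ℂ → ℂ) (D : Set (ℂ × ℂ)) (s : ℝ) (n : ℤ) (x : ℝ × ℝ) :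
    TrMat :=
  (-1 : ℂ) ^ n • momentMat s (moment μ w D x) n (-n)

theorem hasDetOneAdd_tauMat (hD : MeasurableSet D) (hs0 : 0 < s)
    (hs : ∀ p ∈ D, 0 < ‖p.1‖ ∧ ‖p.1‖ < s ∧ s < ‖p.2‖) {x : ℝ × ℝ}
    (hM : ∀ p q, Summable fun y => ‖momentEntry s (moment μ w D x) p q y‖) (n : ℤ) :
    HasDetOneAdd (imul Omega (Cmat μ w D n x.1 x.2)) (detOne (tauMat μ w D s n x)) := by
  have hsc : (s : ℂ) ≠ 0 := Complex.ofReal_ne_zero.2 hs0.ne'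
  refine hasDetOneAdd_of_rows (s := s)
    -- Column `0` carries the factor `s^0`; the shifted exponent places column `b` of `Ω C_n` there,
    -- for every integer `b`.
    (v := fun b => (-1 : ℂ) ^ n • momentMat s (moment μ w D x) n (b - n + 1) 0)
    (imul_Omega_ofNat _) (fun i b => ?_) fun j => L1.ext fun i => ?_
  · rw [imul_Omega_negSucc, Cmat_eq hD hs, L1.smul_apply, momentMat, ofEntries_apply (hM _ _),
      momentEntry]
    have e : b - n + 1 - ((0 : ℕ) : ℤ) - 1 = b - n := by push_cast; ring
    rw [e, smul_eq_mul]
    field_simp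
    rw [pow_zero, mul_one]
  · simp only [tauMat, L1.smul_apply, momentMat, ofEntries_apply (hM _ _), momentEntry]
    have e : Int.negSucc j - n + 1 - ((0 : ℕ) : ℤ) - 1 = -n - j - 1 := by
      rw [Int.negSucc_eq]; push_cast; ring
    rw [e]
    simp only [smul_eq_mul]
    ring

/-- The weight and the plane wave vanish nowhere on `D`, so measurability of `w` is recovered from
one integrability hypothesis. -/
theorem aestronglyMeasurable_density (hD : MeasurableSet D)
    (hs : ∀ p ∈ D, 0 < ‖p.1‖ ∧ ‖p.1‖ < s ∧ s < ‖p.2‖) {x : ℝ × ℝ}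
    (h : IntegrableOn (fun z => momentKernel w 0 0 x z / (weight s z : ℂ)) D μ) :
    AEStronglyMeasurable w (μ.restrict D) := by
  have h2 : Measurable fun z => (weight s z : ℂ) / planeWave x z :=
    (Complex.measurable_ofReal.comp (measurable_weight s)).div (measurable_planeWave x)
  refine (h.aestronglyMeasurable.mul h2.aestronglyMeasurable).congr ?_
  filter_upwards [ae_restrict_mem hD] with z hz
  have h3 : (weight s z : ℂ) ≠ 0 := Complex.ofReal_ne_zero.2 (weight_pos hs hz).ne'
  have h4 := planeWave_ne_zero x z
  simp only [Pi.mul_apply, momentKernel, zpow_zero, mul_one]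
  field_simp

theorem summable_momentEntry_moment (hD : MeasurableSet D) (hs0 : 0 < s)
    (hs : ∀ p ∈ D, 0 < ‖p.1‖ ∧ ‖p.1‖ < s ∧ s < ‖p.2‖) (hV : IsOpen V)
    (hconv : ∀ x ∈ V, ∀ p q : ℤ,
      IntegrableOn (fun z => momentKernel w p q x z / (weight s z : ℂ)) D μ)
    {x : ℝ × ℝ} (hx : x ∈ V) (p q : ℤ) :
    Summable fun y => ‖momentEntry s (moment μ w D x) p q y‖ := by
  obtain ⟨G, hG, hev⟩ := exists_dominates hV hconv hD hs hx
  obtain ⟨u, hu, hub⟩ := hG.exists_summable hs0 hD hs p q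
  exact hu.of_nonneg_of_le (fun _ => norm_nonneg _) (hub x hev.self_of_nhds.2)

theorem hirotaDD_detOne {f : ℝ → ℝ → ℂ} {A : ℝ × ℝ → TrMat} {A₁ A₁m : TrMat} {Am : ℝ → TrMat}
    {x : ℝ × ℝ} (hV : IsOpen V) (hx : x ∈ V) (hf : ∀ y ∈ V, f y.1 y.2 = detOne (A y))
    (hA₁ : HasDerivAt (fun a => A (a, x.2)) A₁ x.1)
    (hAm : ∀ a, (a, x.2) ∈ V → HasDerivAt (fun b => A (a, b)) (Am a) x.2)
    (hA₁m : HasDerivAt Am A₁m x.1) :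
    DifferentiableAt ℝ (fun a => f a x.2) x.1 ∧ DifferentiableAt ℝ (fun b => f x.1 b) x.2 ∧
      DifferentiableAt ℝ (fun a => deriv (fun b => f a b) x.2) x.1 ∧
      hirotaDD f f x.1 x.2 = 2 * (detOne (A x) *
          (fderiv ℂ (fderiv ℂ detOne) (A x) A₁ (Am x.1) + fderiv ℂ detOne (A x) A₁m)
        - fderiv ℂ detOne (A x) A₁ * fderiv ℂ detOne (A x) (Am x.1)) := by
  have hV₁ : ∀ᶠ a in 𝓝 x.1, (a, x.2) ∈ V :=
    (Continuous.prodMk_left x.2).continuousAt.eventually (hV.mem_nhds hx)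
  have hV₂ : ∀ a, (a, x.2) ∈ V → ∀ᶠ b in 𝓝 x.2, (a, b) ∈ V := fun a ha =>
    (Continuous.prodMk_right a).continuousAt.eventually (hV.mem_nhds ha)
  have hf₁ : HasDerivAt (fun a => f a x.2) (fderiv ℂ detOne (A x) A₁) x.1 :=
    (hasDerivAt_detOne_comp hA₁).congr_of_eventuallyEq (hV₁.mono fun a ha => hf _ ha)
  have hfm : ∀ a, (a, x.2) ∈ V → HasDerivAt (fun b => f a b)
      (fderiv ℂ detOne (A (a, x.2)) (Am a)) x.2 := fun a ha =>
    (hasDerivAt_detOne_comp (hAm a ha)).congr_of_eventuallyEq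
      ((hV₂ a ha).mono fun b hb => hf _ hb)
  have hf₁m : HasDerivAt (fun a => deriv (fun b => f a b) x.2)
      (fderiv ℂ (fderiv ℂ detOne) (A x) A₁ (Am x.1) + fderiv ℂ detOne (A x) A₁m) x.1 :=
    (hasDerivAt_fderiv_detOne_comp hA₁ hA₁m).congr_of_eventuallyEq
      (hV₁.mono fun a ha => (hfm a ha).deriv)
  refine ⟨hf₁.differentiableAt, (hfm x.1 hx).differentiableAt, hf₁m.differentiableAt, ?_⟩
  rw [hirotaDD_self hf₁.differentiableAt hf₁m.differentiableAt, hf₁.deriv, hf₁m.deriv,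
    (hfm x.1 hx).deriv, hf x hx]

theorem tauMat_succ (n : ℤ) (x : ℝ × ℝ) : tauMat μ w D s (n + 1) x
    = (-1 : ℂ) ^ n • -momentMat s (moment μ w D x) (n + 1) (-n - 1) := by
  have e : -(n + 1) = -n - 1 := by ring
  rw [tauMat, e, zpow_add_one₀ (by norm_num), mul_neg_one, smul_neg, neg_smul]

theorem tauMat_pred (n : ℤ) (x : ℝ × ℝ) : tauMat μ w D s (n - 1) x
    = (-1 : ℂ) ^ n • -momentMat s (moment μ w D x) (n - 1) (-n + 1) := by
  have e : -(n - 1) = -n + 1 := by ring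
  rw [tauMat, e, zpow_sub_one₀ (by norm_num), inv_neg_one, mul_neg_one, smul_neg, neg_smul]

theorem hasDerivAt_moment_sum (hD : MeasurableSet D) (hs0 : 0 < s)
    (hs : ∀ p ∈ D, 0 < ‖p.1‖ ∧ ‖p.1‖ < s ∧ s < ‖p.2‖) (hV : IsOpen V)
    (hconv : ∀ x ∈ V, ∀ p q : ℤ,
      IntegrableOn (fun z => momentKernel w p q x z / (weight s z : ℂ)) D μ)
    (hw : AEStronglyMeasurable w (μ.restrict D)) (n : ℤ) {x : ℝ × ℝ} (hx : x ∈ V) :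
    HasDerivAt (fun a => momentMat s (moment μ w D (a, x.2)) (n - 1) (-n)
        + momentMat s (moment μ w D (a, x.2)) n (-n - 1))
      (momentMat s (moment μ w D x) n (-n) + momentMat s (moment μ w D x) (n - 1) (-n + 1)
        + (momentMat s (moment μ w D x) (n + 1) (-n - 1) + momentMat s (moment μ w D x) n (-n)))
      x.1 := by
  have h := (hasDerivAt_momentMat hV hs0 hconv hD hs hw (Continuous.prodMk_left x.2)
    (hasDerivAt_planeWave_fst x.2) (n - 1) (-n) hx).add
    (hasDerivAt_momentMat hV hs0 hconv hD hs hw (Continuous.prodMk_left x.2)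
    (hasDerivAt_planeWave_fst x.2) n (-n - 1) hx)
  rwa [sub_add_cancel, sub_add_cancel] at h

theorem tau_bilinear (hD : MeasurableSet D) (hs0 : 0 < s)
    (hs : ∀ p ∈ D, 0 < ‖p.1‖ ∧ ‖p.1‖ < s ∧ s < ‖p.2‖) (hV : IsOpen V)
    (hconv : ∀ x ∈ V, ∀ p q : ℤ,
      IntegrableOn (fun z => momentKernel w p q x z / (weight s z : ℂ)) D μ)
    (n : ℤ) {x : ℝ × ℝ} (hx : x ∈ V) :
    HasDetOneAdd (imul Omega (Cmat μ w D n x.1 x.2)) (tau μ w D n x.1 x.2) ∧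
      DifferentiableAt ℝ (fun a => tau μ w D n a x.2) x.1 ∧
      DifferentiableAt ℝ (fun b => tau μ w D n x.1 b) x.2 ∧
      DifferentiableAt ℝ (fun a => deriv (fun b => tau μ w D n a b) x.2) x.1 ∧
      (1 / 2 : ℂ) * hirotaDD (tau μ w D n) (tau μ w D n) x.1 x.2 =
        tau μ w D n x.1 x.2 ^ 2 - tau μ w D (n + 1) x.1 x.2 * tau μ w D (n - 1) x.1 x.2 := by
  have hsc : (s : ℂ) ≠ 0 := Complex.ofReal_ne_zero.2 hs0.ne'
  have hw := aestronglyMeasurable_density hD hs (hconv x hx 0 0)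
  have hM := fun {y : ℝ × ℝ} (hy : y ∈ V) => summable_momentEntry_moment hD hs0 hs hV hconv hy
  have hdet := fun (n : ℤ) (y : ℝ × ℝ) (hy : y ∈ V) => hasDetOneAdd_tauMat hD hs0 hs (hM hy) n
  have htau : ∀ (n : ℤ) (y : ℝ × ℝ), y ∈ V → tau μ w D n y.1 y.2 = detOne (tauMat μ w D s n y) :=
    fun n y hy => (hdet n y hy).detOneAdd_eq
  have hA₁ := (hasDerivAt_momentMat hV hs0 hconv hD hs hw (Continuous.prodMk_left x.2)
    (hasDerivAt_planeWave_fst x.2) n (-n) hx).const_smul ((-1 : ℂ) ^ n)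
  have hAm := fun (a : ℝ) (ha : (a, x.2) ∈ V) => (hasDerivAt_momentMat hV hs0 hconv hD hs hw
    (Continuous.prodMk_right a) (hasDerivAt_planeWave_snd a) n (-n) ha).const_smul ((-1 : ℂ) ^ n)
  have hA₁m := (hasDerivAt_moment_sum hD hs0 hs hV hconv hw n hx).const_smul ((-1 : ℂ) ^ n)
  obtain ⟨h1, h2, h3, h4⟩ := hirotaDD_detOne hV hx (htau n) hA₁ hAm hA₁m
  refine ⟨(htau n x hx).symm ▸ hdet n x hx, h1, h2, h3, ?_⟩
  have hbil := ((todaRelations_momentMat hsc (hM hx) n).smul ((-1 : ℂ) ^ n)).bilinear hsc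
  rw [h4, htau n x hx, htau (n + 1) x hx, htau (n - 1) x hx, tauMat_succ, tauMat_pred,
    ← mul_assoc, one_div, inv_mul_cancel₀ two_ne_zero, one_mul]
  exact hbil

end Tau

end TodaDL

end

theorem theorem3
    -- the complex measure `dζ = w dμ` and the integration domain `D`
    (μ : MeasureTheory.Measure (ℂ × ℂ)) (w : ℂ × ℂ → ℂ) (D : Set (ℂ × ℂ))
    (hD : MeasurableSet D)
    -- the circle of radius `s` separates the parameters `k ≠ 0` and `k'`
    (s : ℝ) (hs : ∀ p ∈ D, 0 < ‖p.1‖ ∧ ‖p.1‖ < s ∧ s < ‖p.2‖)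
    -- `V` is an open set of values of `(x₁, x₋₁)` on which everything converges absolutely
    (V : Set (ℝ × ℝ)) (hV : IsOpen V)
    (hconv : ∀ x ∈ V, ∀ n i j : ℤ, MeasureTheory.IntegrableOn
      (fun p : ℂ × ℂ => TodaDL.integrandC n x.1 x.2 i j p * w p
        / (((s - ‖p.1‖) * (‖p.2‖ - s) : ℝ) : ℂ)) D μ) :
    ∀ n : ℤ, ∀ x ∈ V,
      TodaDL.HasDetOneAdd
        (TodaDL.imul TodaDL.Omega (TodaDL.Cmat μ w D n x.1 x.2)) (TodaDL.tau μ w D n x.1 x.2) ∧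
      DifferentiableAt ℝ (fun a => TodaDL.tau μ w D n a x.2) x.1 ∧
      DifferentiableAt ℝ (fun b => TodaDL.tau μ w D n x.1 b) x.2 ∧
      DifferentiableAt ℝ (fun a => deriv (fun b => TodaDL.tau μ w D n a b) x.2) x.1 ∧
      (1 / 2 : ℂ) * TodaDL.hirotaDD (TodaDL.tau μ w D n) (TodaDL.tau μ w D n) x.1 x.2 =
        TodaDL.tau μ w D n x.1 x.2 ^ 2
          - TodaDL.tau μ w D (n + 1) x.1 x.2 * TodaDL.tau μ w D (n - 1) x.1 x.2 := by
  intro n x hx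
  rcases D.eq_empty_or_nonempty with hempty | ⟨z₀, hz₀⟩
  · subst hempty
    -- For empty `D` nothing forces `s > 0`, so the radius `1` is used instead.
    exact TodaDL.tau_bilinear hD one_pos (by simp) hV (fun y _ p q => by simp) n hx
  · have hs0 : 0 < s := (hs z₀ hz₀).1.trans (hs z₀ hz₀).2.1
    refine TodaDL.tau_bilinear hD hs0 hs hV (fun y hy p q => ?_) n hx
    -- The index `n` only shifts exponents and changes a sign, so `n = 0` already covers all
    -- moments.
    refine (hconv y hy 0 p q).congr ?_
    filter_upwards [ae_restrict_mem hD] with z hz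
    obtain ⟨h1, h2, h3⟩ := hs z hz
    rw [TodaDL.integrandC_eq 0 p q y (norm_pos_iff.1 h1) (norm_pos_iff.1 (h1.trans (h2.trans h3))),
      TodaDL.momentKernel, TodaDL.weight, zpow_zero, one_mul, zero_add, sub_zero]
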